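/- All graphs are finite and simple. A \emph{subdivision} of a graph $H$ is a graph obtained from $H$ by a (possibly empty) sequence of edge subdivisions, where subdividing an edge $uv$ means replacing it by two edges $uw$, $wv$ with a new vertex $w$. A graph $G$ is \emph{$H$-induced-topological-minor-free} if no induced subgraph of $G$ is isomorphic to a subdivision of $H$. Write $H\subseteq_{is} G$ if $H$ is isomorphic to an induced subgraph of $G$, $\omega(G)$ for the clique number and $\mathrm{tw}(G)$ for the treewidth of $G$ (with $\mathrm{tw}=0$ for the graph without vertices). A function $f:\mathbb{N}\to\mathbb{N}$ is a \emph{$(\mathrm{tw},\omega)$-binding function} for a graph class $\mathcal{G}$ if $\mathrm{tw}(G')\le f(\omega(G'))$ for every $G\in\mathcal{G}$ and every induced subgraph $G'$ of $G$; the class $\mathcal{G}$ is \emph{$(\mathrm{tw},\omega)$-bounded} if it has such a function. Let $C_\ell$ be the cycle on $\ell$ vertices and $K_4^-$ the complete graph on four vertices minus one edge (the diamond). For integers $k\ge 1$ and $\ell\ge 0$, let $R(k,\ell)$ be the least positive integer such that every graph with at least $R(k,\ell)$ vertices contains a clique of size $k$ or an independent set of size $\ell$. \textbf{Theorem.} Let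 $H$ be a graph. The class of $H$-induced-topological-minor-free graphs is $(\mathrm{tw},\omega)$-bounded if and only if one of the following conditions holds: \begin{enumerate} \item $H\subseteq_{is} C_3$ or $H\subseteq_{is} C_4$, in which case a binding function is $f(k)=k-1$; \item $H\cong K_4^-$, in which case a binding function is $f(k)=\max\{k-1,2\}$; \item $H$ is edgeless, in which case a binding function is $f(k)=R(k+1,|V(H)|)-2$. \end{enumerate} (Negative values of these expressions are read as $0$; this matters only for $k=0$ or when $H$ has at most one vertex.) -/

import Mathlib

universe u v

namespace TwOmega

/-- A tree decomposition of `G` whose tree has the finite vertex set `ι`. -/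
structure TreeDecomposition {V : Type v} (G : SimpleGraph V) (ι : Type) where
  /-- the underlying tree -/
  tree : SimpleGraph ι
  isTree : tree.IsTree
  /-- the vertex subset associated with a node of the tree -/
  bag : ι → Finset V
  exists_mem_bag : ∀ x : V, ∃ t, x ∈ bag t
  exists_edge_bag : ∀ x y : V, G.Adj x y → ∃ t, x ∈ bag t ∧ y ∈ bag t
  connected_nodes : ∀ x : V, (tree.induce {t | x ∈ bag t}).Connected

/-- The width `max_t |X_t| - 1`. For a graph with no vertices and all bags empty the (truncated)
value is `0`; a graph with a vertex has a nonempty bag, so nothing is truncated there. -/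
def TreeDecomposition.width {V : Type v} {G : SimpleGraph V} {ι : Type} [Fintype ι]
    (D : TreeDecomposition G ι) : ℕ :=
  (Finset.univ.sup fun t => (D.bag t).card) - 1

/-- The treewidth of a (finite) graph: the minimum width of a tree decomposition. -/
noncomputable def treewidth {V : Type v} (G : SimpleGraph V) : ℕ :=
  sInf {w : ℕ | ∃ (ι : Type) (_ : Fintype ι) (D : TreeDecomposition G ι), D.width = w}

/-- The subdivision of the edge `xy`: the edge is removed, and a new vertex `none` is added that
is adjacent exactly to `x` and `y`. -/
def subdivideEdge {V : Type u} (G : SimpleGraph V) (x y : V) : SimpleGraph (Option V) where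
  Adj
    | some a, some b => G.Adj a b ∧ s(a, b) ≠ s(x, y)
    | some a, none => a = x ∨ a = y
    | none, some b => b = x ∨ b = y
    | none, none => False
  symm := ⟨by
    rintro (_ | a) (_ | b) h
    · exact h
    · exact h
    · exact h
    · exact ⟨h.1.symm, by rw [Sym2.eq_swap]; exact h.2⟩⟩
  loopless := ⟨by
    rintro (_ | a) h
    · exact h
    · exact G.loopless.irrefl a h.1⟩

/-- `IsSubdivision H K`: the graph `K` is obtained from `H` by a finite sequence of edge
subdivisions. -/
inductive IsSubdivision {V : Type u} (H : SimpleGraph V) :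
    (W : Type u) → SimpleGraph W → Prop
  | refl : IsSubdivision H V H
  | step {W : Type u} {K : SimpleGraph W} {x y : W} (hK : IsSubdivision H W K)
      (hxy : K.Adj x y) : IsSubdivision H (Option W) (subdivideEdge K x y)

/-- `H` is an induced topological minor of `G`: some subdivision of `H` is (isomorphic to) an
induced subgraph of `G`. -/
def IsInducedTopologicalMinor {U : Type u} {V : Type v} (H : SimpleGraph U)
    (G : SimpleGraph V) : Prop :=
  ∃ (W : Type u) (K : SimpleGraph W), IsSubdivision H W K ∧ K.IsIndContained G

/-- A class of graphs. Only its finite members matter below. -/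
abbrev GraphClass : Type (v + 1) := (V : Type v) → SimpleGraph V → Prop

/-- The class of `H`-induced-topological-minor-free graphs. -/
def itmFree {U : Type u} (H : SimpleGraph U) : GraphClass.{v} :=
  fun _ G => ¬ IsInducedTopologicalMinor H G

/-- `f` is a `(tw, ω)`-binding function for the class `𝒢` of finite graphs. -/
def IsTwOmegaBinding (𝒢 : GraphClass.{v}) (f : ℕ → ℕ) : Prop :=
  ∀ (V : Type v) [Finite V] (G : SimpleGraph V), 𝒢 V G →
    ∀ s : Set V, treewidth (G.induce s) ≤ f (G.induce s).cliqueNum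

/-- The class `𝒢` of finite graphs is `(tw, ω)`-bounded. -/
def IsTwOmegaBounded (𝒢 : GraphClass.{v}) : Prop :=
  ∃ f : ℕ → ℕ, IsTwOmegaBinding 𝒢 f

/-- The graph `K₄⁻`, that is, `K₄` with one edge removed. -/
def diamond : SimpleGraph (Fin 4) :=
  (⊤ : SimpleGraph (Fin 4)).deleteEdges {s(0, 1)}

/-- The Ramsey number `R(k, l)`: the least positive integer `n` such that every graph with at
least `n` vertices has a clique of size `k` or an independent set of size `l`. -/
noncomputable def ramseyNumber (k l : ℕ) : ℕ :=
  sInf {n : ℕ | 0 < n ∧ ∀ m : ℕ, n ≤ m → ∀ G : SimpleGraph (Fin m),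
    (∃ s, G.IsNClique k s) ∨ (∃ s, G.IsNIndepSet l s)}

end TwOmega

namespace TwOmega

open SimpleGraph

/-! ### Connected vertex sets -/

/-! Sufficiency. Subtrees of a tree have the Helly property (`exists_mem_of_pairwise_inter`), so
every clique lies in a bag, and tree decompositions of the two sides of a clique separation can be
glued without enlarging bags. Hence only graphs without a clique separation (atoms) matter
(`hasTreeDecomposition_of_atoms`). An atom that is not complete contains a hole
(`exists_isCliqueSeparation_or_hole`). Every hole is a subdivision of both C₃ and C₄, so in the
first case all atoms are complete and bags of size ω suffice. In the diamond case an atom with a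
hole is that hole (`IsHole.exists_eq`), which has bags of size 3. In the edgeless case Ramsey's
theorem bounds the number of vertices. Generalised theta graphs (`multiTheta`) describe the
subdivisions of C₃, C₄ and the diamond uniformly.

Necessity. Balanced complete bipartite graphs and line graphs of grids have bounded clique number,
while brambles of crosses give them unbounded treewidth (`le_treewidth_of_crosses`). So some member
of each family contains an induced subdivision of H. Line graphs are claw-free and claws survive
subdivision, hence H is claw-free. An induced subgraph of a complete bipartite graph is again
complete bipartite, and undoing subdivisions leads only to complete bipartite graphs and books
K_{1,1,q} (`IsSubdivision.isCompleteBip_or_isBook`). The claw-free ones among these are exactly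
covered by the listed cases (`IsTwOmegaBounded.forbidden_cases`). -/

theorem exists_walk_support_subset {ι : Type*} {T : SimpleGraph ι} {S : Set ι}
    (hS : (T.induce S).Preconnected) {a b : ι} (ha : a ∈ S) (hb : b ∈ S) :
    ∃ p : T.Walk a b, ∀ x ∈ p.support, x ∈ S := by
  obtain ⟨p⟩ := hS ⟨a, ha⟩ ⟨b, hb⟩
  refine ⟨p.map (SimpleGraph.Embedding.induce S).toHom, fun x hx => ?_⟩
  obtain ⟨y, -, rfl⟩ := List.mem_map.1 ((Walk.support_map _ p) ▸ hx)
  exact y.2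

theorem Preconnected.induce_image {α β : Type*} {G : SimpleGraph α} {G' : SimpleGraph β}
    (f : G →g G') {s : Set α} (hs : (G.induce s).Preconnected) :
    (G'.induce (f '' s)).Preconnected := by
  rintro ⟨_, a, ha, rfl⟩ ⟨_, b, hb, rfl⟩
  have := (hs ⟨a, ha⟩ ⟨b, hb⟩).map (⟨fun x => ⟨f x.1, x.1, x.2, rfl⟩, fun h => f.map_adj h⟩ :
    G.induce s →g G'.induce (f '' s))
  exact this

/-! ### The Helly property of subtrees -/

/-- Pairwise intersecting subtrees of a tree have a common node. -/
theorem exists_mem_of_pairwise_inter {ι κ : Type*} [Finite κ] {T : SimpleGraph ι} (hT : T.IsTree)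
    (S : κ → Set ι) (hS : ∀ k, (T.induce (S k)).Preconnected)
    (h : ∀ k l, (S k ∩ S l).Nonempty) : ∃ t, ∀ k, t ∈ S k := by
  classical
  obtain ⟨r⟩ := hT.connected.nonempty
  cases isEmpty_or_nonempty κ
  · exact ⟨r, fun k => isEmptyElim k⟩
  -- Root the tree at `r` and let `s k` be the top of the subtree `S k`. The lowest of these tops
  -- lies in all the subtrees.
  have hmin : ∀ k, ∃ s ∈ S k, ∀ x ∈ S k, T.dist r s ≤ T.dist r x := fun k => by
    obtain ⟨s, hs, hs'⟩ := WellFounded.has_min (InvImage.wf (T.dist r) Nat.lt_wfRel.wf) (S k)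
      ((h k k).mono Set.inter_subset_left)
    exact ⟨s, hs, fun x hx => not_lt.1 (hs' x hx)⟩
  choose s hs hs' using hmin
  obtain ⟨k, hk⟩ := Finite.exists_max fun k => T.dist r (s k)
  refine ⟨s k, fun l => ?_⟩
  by_contra hl
  obtain ⟨z, hzk, hzl⟩ := h k l
  obtain ⟨q, hq⟩ := hT.connected.exists_walk_length_eq_dist r (s l)
  -- If `s k` is not in `S l`, one reaches `z` from `r` through `s l` while avoiding `s k`. The path
  -- through `s k` also leads to `z`, against uniqueness of paths in a tree.
  have hqs : s k ∉ q.support := fun hmem => by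
    have h1 := dist_le (q.takeUntil _ hmem)
    have h2 : (q.takeUntil _ hmem).length < q.length :=
      q.length_takeUntil_lt_length hmem (fun e => hl (e ▸ hs l))
    have h3 := hk l
    omega
  obtain ⟨q', hq'⟩ := exists_walk_support_subset (hS l) (hs l) hzl
  have hA : s k ∉ (q.append q').support := by
    rw [Walk.mem_support_append_iff]
    exact fun hm => hm.elim hqs fun hm => hl (hq' _ hm)
  obtain ⟨p, hp, hpl⟩ := hT.connected.exists_path_of_dist r (s k)
  obtain ⟨p', hp'⟩ := exists_walk_support_subset (hS k) (hs k) hzk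
  have hp'' : ∀ x ∈ p'.bypass.support, x ∈ S k := fun x hx =>
    hp' x (p'.support_bypass_subset_support hx)
  have hpath : (p.append p'.bypass).IsPath := by
    rw [Walk.isPath_def, Walk.support_append, List.nodup_append]
    have hnd := p'.bypass_isPath.support_nodup
    refine ⟨hp.support_nodup, hnd.tail, fun a ha b hb hab => ?_⟩
    subst hab
    have h1 : T.dist r (s k) ≤ T.dist r a := hs' k a (hp'' a (List.mem_of_mem_tail hb))
    have hne : a ≠ s k := by
      rintro rfl
      rw [← Walk.cons_tail_support, List.nodup_cons] at hnd
      exact hnd.1 hb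
    have h2 := dist_le (p.takeUntil _ ha)
    have h3 := p.length_takeUntil_lt_length ha hne
    omega
  have huniq : p.append p'.bypass = (q.append q').bypass := congrArg Subtype.val
    ((hT.isAcyclic.subsingleton_path r z).elim ⟨_, hpath⟩ ⟨_, (q.append q').bypass_isPath⟩)
  apply hA
  apply Walk.support_bypass_subset_support
  rw [← huniq]
  simp

/-! ### Tree decompositions -/

/-- `G` has a tree decomposition all of whose bags have at most `k` vertices. -/
def HasTreeDecomposition {V : Type v} (G : SimpleGraph V) (k : ℕ) : Prop :=
  ∃ (ι : Type) (_ : Fintype ι) (D : TreeDecomposition G ι), ∀ t, (D.bag t).card ≤ k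

theorem HasTreeDecomposition.treewidth_le {V : Type v} {G : SimpleGraph V} {k : ℕ}
    (h : HasTreeDecomposition G k) : treewidth G ≤ k - 1 := by
  obtain ⟨ι, hι, D, hD⟩ := h
  have h1 : treewidth G ≤ D.width := Nat.sInf_le ⟨ι, hι, D, rfl⟩
  refine h1.trans ?_
  exact Nat.sub_le_sub_right (Finset.sup_le fun t _ => hD t) 1

theorem hasTreeDecomposition_of_card_le {V : Type v} [Finite V] (G : SimpleGraph V) {k : ℕ}
    (h : Nat.card V ≤ k) : HasTreeDecomposition G k := by
  have := Fintype.ofFinite V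
  refine ⟨Unit, inferInstance, ⟨⊥, IsTree.of_subsingleton, fun _ => Finset.univ,
    fun x => ⟨(), by simp⟩, fun x y _ => ⟨(), by simp⟩, fun x => ?_⟩, fun _ => ?_⟩
  · have : Nonempty {t : Unit | x ∈ (Finset.univ : Finset V)} := ⟨⟨(), by simp⟩⟩
    exact IsTree.of_subsingleton.connected
  · rwa [Finset.card_univ, ← Nat.card_eq_fintype_card]

theorem hasTreeDecomposition_of_treewidth_le {V : Type v} [Finite V] {G : SimpleGraph V} {k : ℕ}
    (h : treewidth G ≤ k) : HasTreeDecomposition G (k + 1) := by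
  -- Some decomposition exists, so the infimum is attained and is not the default value of `sInf ∅`.
  have hne : {w : ℕ | ∃ (ι : Type) (_ : Fintype ι) (D : TreeDecomposition G ι),
      D.width = w}.Nonempty := by
    obtain ⟨ι, hι, D, -⟩ := hasTreeDecomposition_of_card_le G le_rfl
    exact ⟨D.width, ι, hι, D, rfl⟩
  obtain ⟨ι, hι, D, hD⟩ := Nat.sInf_mem hne
  refine ⟨ι, hι, D, fun t => ?_⟩
  have h1 : (D.bag t).card ≤ Finset.univ.sup fun t => (D.bag t).card :=
    Finset.le_sup (f := fun t => (D.bag t).card) (Finset.mem_univ t)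
  have h2 : D.width ≤ k := hD.trans_le h
  rw [TreeDecomposition.width] at h2
  omega

theorem HasTreeDecomposition.of_iso {V W : Type*} {G : SimpleGraph V} {G' : SimpleGraph W} {k : ℕ}
    (e : G ≃g G') (h : HasTreeDecomposition G k) : HasTreeDecomposition G' k := by
  obtain ⟨ι, hι, D, hD⟩ := h
  refine ⟨ι, hι, ⟨D.tree, D.isTree, fun t => (D.bag t).map e.toEquiv.toEmbedding, fun x => ?_,
    fun x y hxy => ?_, fun x => ?_⟩, fun t => by simpa using hD t⟩
  · obtain ⟨t, ht⟩ := D.exists_mem_bag (e.symm x)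
    exact ⟨t, Finset.mem_map_equiv.2 ht⟩
  · obtain ⟨t, ht, ht'⟩ := D.exists_edge_bag (e.symm x) (e.symm y) (e.symm.map_adj_iff.2 hxy)
    exact ⟨t, Finset.mem_map_equiv.2 ht,
      Finset.mem_map_equiv.2 ht'⟩
  · rw [show {t | x ∈ (D.bag t).map e.toEquiv.toEmbedding} = {t | e.symm x ∈ D.bag t} from
      Set.ext fun t => Finset.mem_map_equiv]
    exact D.connected_nodes (e.symm x)

/-- Every clique is contained in a bag. -/
theorem TreeDecomposition.exists_bag_of_isClique {V : Type v} [Finite V] {G : SimpleGraph V}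
    {ι : Type} (D : TreeDecomposition G ι) {K : Set V} (hK : G.IsClique K) :
    ∃ t, ∀ x ∈ K, x ∈ D.bag t := by
  obtain ⟨t, ht⟩ := exists_mem_of_pairwise_inter D.isTree (fun x : K => {t | x.1 ∈ D.bag t})
    (fun x => (D.connected_nodes x).preconnected) (fun x y => by
      by_cases hxy : x = y
      · subst hxy
        simpa [Set.Nonempty] using D.exists_mem_bag x
      · exact D.exists_edge_bag x y (hK x.2 y.2 (fun e => hxy (Subtype.ext e))))
  exact ⟨t, fun x hx => ht ⟨x, hx⟩⟩

/-- Two trees joined by an edge form a tree. -/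
theorem isTree_sum_sup_edge {α β : Type*} [Finite α] [Finite β] {S : SimpleGraph α}
    {T : SimpleGraph β} (hS : S.IsTree) (hT : T.IsTree) (a : α) (b : β) :
    ((S ⊕g T) ⊔ SimpleGraph.edge (Sum.inl a) (Sum.inr b)).IsTree := by
  rw [isTree_iff_connected_and_card] at hS hT ⊢
  refine ⟨hS.1.sum_sup_edge hT.1, ?_⟩
  have h1 : Nat.card (S ⊕g T).edgeSet = Nat.card S.edgeSet + Nat.card T.edgeSet := by
    rw [Nat.card_congr edgeSetSumEquiv, Nat.card_sum]
  have h2 : ((S ⊕g T) ⊔ SimpleGraph.edge (Sum.inl a) (Sum.inr b)).edgeSet =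
      insert s(Sum.inl a, Sum.inr b) (S ⊕g T).edgeSet := by
    rw [edgeSet_sup, edgeSet_edge, sdiff_eq_left.2 (by simp), Set.union_comm, Set.singleton_union]
  rw [h2, Nat.card_coe_set_eq, Set.ncard_insert_of_notMem (by simp), ← Nat.card_coe_set_eq, h1,
    Nat.card_sum]
  omega

/-- Gluing tree decompositions along a clique. -/
theorem HasTreeDecomposition.glue {V : Type v} [Finite V] {G : SimpleGraph V} {k : ℕ} {A B : Set V}
    (hAB : A ∪ B = Set.univ) (hK : G.IsClique (A ∩ B))
    (hadj : ∀ x ∈ A, x ∉ B → ∀ y ∈ B, y ∉ A → ¬ G.Adj x y)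
    (hA : HasTreeDecomposition (G.induce A) k) (hB : HasTreeDecomposition (G.induce B) k) :
    HasTreeDecomposition G k := by
  classical
  obtain ⟨ι, hι, D, hD⟩ := hA
  obtain ⟨κ, hκ, E, hE⟩ := hB
  -- The clique `A ∩ B` lies in a bag on either side. The edge between these two nodes joins the
  -- trees, and connects the two subtrees of each vertex of `A ∩ B`.
  obtain ⟨a, ha⟩ := D.exists_bag_of_isClique (K := {x | x.1 ∈ B}) (fun x hx y hy hxy =>
    hK ⟨x.2, hx⟩ ⟨y.2, hy⟩ (fun e => hxy (Subtype.ext e)))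
  obtain ⟨b, hb⟩ := E.exists_bag_of_isClique (K := {x | x.1 ∈ A}) (fun x hx y hy hxy =>
    hK ⟨hx, x.2⟩ ⟨hy, y.2⟩ (fun e => hxy (Subtype.ext e)))
  have hmem : ∀ x, x ∈ A ∨ x ∈ B := fun x => by
    have : x ∈ A ∪ B := hAB ▸ Set.mem_univ x
    exact this
  refine ⟨ι ⊕ κ, inferInstance, ⟨_, isTree_sum_sup_edge D.isTree E.isTree a b,
    Sum.elim (fun t => (D.bag t).map (Function.Embedding.subtype _))
      (fun t => (E.bag t).map (Function.Embedding.subtype _)), fun x => ?_, fun x y hxy => ?_,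
      fun x => ?_⟩, ?_⟩
  · rcases hmem x with hx | hx
    · obtain ⟨t, ht⟩ := D.exists_mem_bag ⟨x, hx⟩
      exact ⟨Sum.inl t, by simpa using ⟨hx, ht⟩⟩
    · obtain ⟨t, ht⟩ := E.exists_mem_bag ⟨x, hx⟩
      exact ⟨Sum.inr t, by simpa using ⟨hx, ht⟩⟩
  · have : (x ∈ A ∧ y ∈ A) ∨ (x ∈ B ∧ y ∈ B) := by
      by_contra hcon
      have h1 := hmem x
      have h2 := hmem y
      have h3 := hadj x
      have h4 := hadj y
      have h5 := hxy.symm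
      tauto
    rcases this with ⟨hx, hy⟩ | ⟨hx, hy⟩
    · obtain ⟨t, ht, ht'⟩ := D.exists_edge_bag ⟨x, hx⟩ ⟨y, hy⟩ hxy
      exact ⟨Sum.inl t, by simpa using ⟨hx, ht⟩, by simpa using ⟨hy, ht'⟩⟩
    · obtain ⟨t, ht, ht'⟩ := E.exists_edge_bag ⟨x, hx⟩ ⟨y, hy⟩ hxy
      exact ⟨Sum.inr t, by simpa using ⟨hx, ht⟩, by simpa using ⟨hy, ht'⟩⟩
  · let T := (D.tree ⊕g E.tree) ⊔ SimpleGraph.edge (Sum.inl a) (Sum.inr b)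
    have h1 : ∀ hx : x ∈ A, (T.induce (Sum.inl '' {t | (⟨x, hx⟩ : A) ∈ D.bag t})).Preconnected :=
      fun hx => Preconnected.induce_image (G' := T) ⟨Sum.inl, fun h => by simp [T, h]⟩
        (D.connected_nodes ⟨x, hx⟩).preconnected
    have h2 : ∀ hx : x ∈ B, (T.induce (Sum.inr '' {t | (⟨x, hx⟩ : B) ∈ E.bag t})).Preconnected :=
      fun hx => Preconnected.induce_image (G' := T) ⟨Sum.inr, fun h => by simp [T, h]⟩
        (E.connected_nodes ⟨x, hx⟩).preconnected
    set S : Set (ι ⊕ κ) := {t | x ∈ Sum.elim (fun t => (D.bag t).map (Function.Embedding.subtype _))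
      (fun t => (E.bag t).map (Function.Embedding.subtype _)) t} with hS
    change (T.induce S).Connected
    by_cases hxA : x ∈ A <;> by_cases hxB : x ∈ B
    · rw [show S = Sum.inl '' {t | (⟨x, hxA⟩ : A) ∈ D.bag t} ∪
        Sum.inr '' {t | (⟨x, hxB⟩ : B) ∈ E.bag t} by ext (t | t) <;> simp [hS, hxA, hxB]]
      exact connected_induce_union (h1 hxA) (h2 hxB) (v := Sum.inl a) (w := Sum.inr b)
        ⟨a, ha _ hxB, rfl⟩ ⟨b, hb _ hxA, rfl⟩ (by simp [T, SimpleGraph.edge])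
    · rw [show S = Sum.inl '' {t | (⟨x, hxA⟩ : A) ∈ D.bag t} by
        ext (t | t) <;> simp [hS, hxA, hxB]]
      obtain ⟨⟨t, ht⟩⟩ := (D.connected_nodes ⟨x, hxA⟩).nonempty
      exact Connected.mk (h1 hxA) (nonempty := ⟨⟨_, t, ht, rfl⟩⟩)
    · rw [show S = Sum.inr '' {t | (⟨x, hxB⟩ : B) ∈ E.bag t} by
        ext (t | t) <;> simp [hS, hxA, hxB]]
      obtain ⟨⟨t, ht⟩⟩ := (E.connected_nodes ⟨x, hxB⟩).nonempty
      exact Connected.mk (h2 hxB) (nonempty := ⟨⟨_, t, ht, rfl⟩⟩)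
    · exact absurd (hmem x) (by tauto)
  · rintro (t | t)
    · simpa using hD t
    · simpa using hE t

/-- Every edge is a bridge: a walk that avoids the edge from `i` to `i + 1` cannot leave the initial
segment up to `i`. -/
theorem isTree_pathGraph (m : ℕ) : (pathGraph (m + 1)).IsTree := by
  refine ⟨pathGraph_connected m, ?_⟩
  rw [isAcyclic_iff_forall_adj_isBridge]
  have key : ∀ i j : Fin (m + 1), i.1 + 1 = j.1 → (pathGraph (m + 1)).IsBridge s(i, j) := by
    intro i j hij
    rw [isBridge_iff]
    rintro ⟨p⟩
    have : ∀ {a b : Fin (m + 1)}, ((pathGraph (m + 1)).deleteEdges {s(i, j)}).Walk a b →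
        a.1 ≤ i.1 → b.1 ≤ i.1 := by
      intro a b p
      induction p with
      | nil => exact id
      | @cons a b c h p ih =>
        intro ha
        apply ih
        rw [deleteEdges_adj, pathGraph_adj, Set.mem_singleton_iff] at h
        by_contra hb
        have h1 : a = i := Fin.ext (by omega)
        have h2 : b = j := Fin.ext (by omega)
        exact h.2 (by rw [h1, h2])
    have := this p le_rfl
    omega
  intro i j h
  rcases pathGraph_adj.1 h with h | h
  · exact key i j h
  · rw [Sym2.eq_swap]
    exact key j i h

/-- A path decomposition is a tree decomposition. -/
theorem hasTreeDecomposition_of_path {V : Type v} {G : SimpleGraph V} {k m : ℕ}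
    (bag : Fin (m + 1) → Finset V) (hbag : ∀ t, (bag t).card ≤ k) (hV : ∀ x, ∃ t, x ∈ bag t)
    (hE : ∀ x y, G.Adj x y → ∃ t, x ∈ bag t ∧ y ∈ bag t)
    (hint : ∀ x (i j l : Fin (m + 1)), i ≤ j → j ≤ l → x ∈ bag i → x ∈ bag l → x ∈ bag j) :
    HasTreeDecomposition G k := by
  refine ⟨Fin (m + 1), inferInstance, ⟨pathGraph (m + 1), isTree_pathGraph m, bag, hV, hE,
    fun x => ?_⟩, hbag⟩
  obtain ⟨t, ht⟩ := hV x
  set S : Set (Fin (m + 1)) := {t | x ∈ bag t} with hS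
  have key : ∀ (d : ℕ) (a b : S), a.1.1 + d = b.1.1 →
      ((pathGraph (m + 1)).induce S).Reachable a b := by
    intro d
    induction d with
    | zero =>
      intro a b h
      rw [show a = b from Subtype.ext (Fin.ext h)]
    | succ d ih =>
      intro a b h
      have hb := b.1.2
      have hc : (⟨a.1.1 + 1, by omega⟩ : Fin (m + 1)) ∈ S :=
        hint x a.1 _ b.1 (by simp [Fin.le_def]) (by rw [Fin.le_def]; simp only; omega) a.2 b.2
      refine Reachable.trans (Adj.reachable ?_) (ih ⟨_, hc⟩ b (by simp only; omega))
      rw [comap_adj]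
      exact pathGraph_adj.2 (Or.inl rfl)
  refine Connected.mk (fun a b => ?_) (nonempty := ⟨⟨t, ht⟩⟩)
  rcases le_total a.1.1 b.1.1 with h | h
  · exact key (b.1.1 - a.1.1) a b (by omega)
  · exact (key (a.1.1 - b.1.1) b a (by omega)).symm

/-! ### Brambles -/

/-- For a finite family of pairwise touching connected vertex sets some bag meets all of them. -/
theorem TreeDecomposition.exists_bag_inter_bramble {V : Type v} {κ : Type*} [Finite κ]
    {G : SimpleGraph V} {ι : Type} (D : TreeDecomposition G ι) (B : κ → Set V)
    (hB : ∀ k, (G.induce (B k)).Preconnected)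
    (htouch : ∀ k l, ∃ x ∈ B k, ∃ y ∈ B l, x = y ∨ G.Adj x y) :
    ∃ t, ∀ k, ∃ x ∈ B k, x ∈ D.bag t := by
  refine exists_mem_of_pairwise_inter D.isTree (fun k => {t | ∃ x ∈ B k, x ∈ D.bag t}) ?_ ?_
  · intro k
    set S := {t | ∃ x ∈ B k, x ∈ D.bag t} with hS
    -- The nodes whose bags meet a connected set form a subtree: a walk in the set is followed
    -- through the overlapping subtrees of its vertices. Touching sets have intersecting subtrees,
    -- so the Helly property applies.
    have hx : ∀ (x : B k) (t t' : S), x.1 ∈ D.bag t → x.1 ∈ D.bag t' →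
        (D.tree.induce S).Reachable t t' := by
      intro x t t' ht ht'
      have hle : {t | x.1 ∈ D.bag t} ≤ S := fun t ht => ⟨x, x.2, ht⟩
      exact ((D.connected_nodes x).preconnected ⟨t, ht⟩ ⟨t', ht'⟩).map
        (induceHomOfLE _ hle).toHom
    have key : ∀ {x y : B k} (_ : (G.induce (B k)).Walk x y) (t t' : S), x.1 ∈ D.bag t →
        y.1 ∈ D.bag t' → (D.tree.induce S).Reachable t t' := by
      intro x y p
      induction p with
      | nil => exact hx _
      | @cons x z y h p ih =>
        intro t t' ht ht'
        obtain ⟨s, hs, hs'⟩ := D.exists_edge_bag _ _ h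
        exact (hx x t ⟨s, x, x.2, hs⟩ ht hs).trans (ih ⟨s, x, x.2, hs⟩ t' hs' ht')
    rintro ⟨t, x, hx, ht⟩ ⟨t', y, hy, ht'⟩
    obtain ⟨p⟩ := hB k ⟨x, hx⟩ ⟨y, hy⟩
    exact key p _ _ ht ht'
  · intro k l
    obtain ⟨x, hx, y, hy, rfl | h⟩ := htouch k l
    · obtain ⟨t, ht⟩ := D.exists_mem_bag x
      exact ⟨t, ⟨x, hx, ht⟩, x, hy, ht⟩
    · obtain ⟨t, ht, hs⟩ := D.exists_edge_bag _ _ h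
      exact ⟨t, ⟨x, hx, ht⟩, y, hy, hs⟩

/-- The bramble lower bound for treewidth. -/
theorem le_treewidth_of_bramble {V : Type v} [Finite V] {κ : Type*} [Finite κ] {G : SimpleGraph V}
    {n : ℕ} (B : κ → Set V) (hB : ∀ k, (G.induce (B k)).Preconnected)
    (htouch : ∀ k l, ∃ x ∈ B k, ∃ y ∈ B l, x = y ∨ G.Adj x y)
    (hcover : ∀ X : Finset V, (∀ k, ∃ x ∈ B k, x ∈ X) → n < X.card) : n ≤ treewidth G := by
  obtain ⟨ι, hι, D, hD⟩ := hasTreeDecomposition_of_treewidth_le (G := G) le_rfl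
  obtain ⟨t, ht⟩ := D.exists_bag_inter_bramble B hB htouch
  have := (hcover _ ht).trans_le (hD t)
  omega

/-! ### Subdivisions up to isomorphism -/

/-- Subdividing corresponding edges of isomorphic graphs yields isomorphic graphs. -/
def subdivideEdgeIso {V W : Type*} {G : SimpleGraph V} {G' : SimpleGraph W} (e : G ≃g G')
    (x y : V) : subdivideEdge G x y ≃g subdivideEdge G' (e x) (e y) where
  toEquiv := e.toEquiv.optionCongr
  map_rel_iff' := by
    have hs : ∀ a b c d : V, s(e a, e b) = s(e c, e d) ↔ s(a, b) = s(c, d) := fun a b c d => by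
      simp
    rintro (_ | a) (_ | b)
    · exact Iff.rfl
    · change (e b = e x ∨ e b = e y) ↔ (b = x ∨ b = y)
      simp
    · change (e a = e x ∨ e a = e y) ↔ (a = x ∨ a = y)
      simp
    · change (G'.Adj (e a) (e b) ∧ s(e a, e b) ≠ s(e x, e y)) ↔ (G.Adj a b ∧ s(a, b) ≠ s(x, y))
      rw [e.map_adj_iff, Ne, hs]

/-- `K` is isomorphic to a subdivision of `H`. -/
def IsIsoSubdivision {U : Type u} {V : Type*} (H : SimpleGraph U) (K : SimpleGraph V) : Prop :=
  ∃ (W : Type u) (K' : SimpleGraph W), IsSubdivision H W K' ∧ Nonempty (K ≃g K')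

theorem IsIsoSubdivision.refl {U : Type u} (H : SimpleGraph U) : IsIsoSubdivision H H :=
  ⟨U, H, .refl, ⟨Iso.refl⟩⟩

theorem IsIsoSubdivision.step {U : Type u} {V W : Type*} {H : SimpleGraph U} {K : SimpleGraph V}
    {K₁ : SimpleGraph W} (h : IsIsoSubdivision H K) {x y : V} (hxy : K.Adj x y)
    (e : K₁ ≃g subdivideEdge K x y) : IsIsoSubdivision H K₁ := by
  obtain ⟨W', K', hK', ⟨e'⟩⟩ := h
  exact ⟨_, _, hK'.step (e'.map_adj_iff.2 hxy), ⟨e.trans (subdivideEdgeIso e' x y)⟩⟩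

theorem IsIsoSubdivision.isInducedTopologicalMinor {U : Type u} {V W : Type*} {H : SimpleGraph U}
    {K : SimpleGraph V} {G : SimpleGraph W} (h : IsIsoSubdivision H K) (hG : K.IsIndContained G) :
    IsInducedTopologicalMinor H G := by
  obtain ⟨W', K', hK', ⟨e'⟩⟩ := h
  exact ⟨W', K', hK', IsIndContained.trans ⟨e'.symm.toEmbedding⟩ hG⟩

/-- An induced subgraph of `H` has a subdivision inside every subdivision of `H`. -/
theorem IsSubdivision.exists_of_isIndContained {U' : Type u} {U : Type v} {H' : SimpleGraph U'}
    {H : SimpleGraph U} (hH : H'.IsIndContained H) {W : Type v} {K : SimpleGraph W}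
    (hK : IsSubdivision H W K) :
    ∃ (W' : Type u) (K' : SimpleGraph W'), IsSubdivision H' W' K' ∧ K'.IsIndContained K := by
  induction hK with
  | refl => exact ⟨_, _, .refl, hH⟩
  | @step W K x y hK hxy ih =>
    obtain ⟨W', K', hK', ⟨f⟩⟩ := ih
    -- If both ends of the edge lie in the copy, the same edge is subdivided there. Otherwise the
    -- copy loses no edge and remains induced.
    by_cases hx : (∃ x', f x' = x) ∧ ∃ y', f y' = y
    · obtain ⟨⟨x', rfl⟩, ⟨y', rfl⟩⟩ := hx
      refine ⟨_, _, hK'.step (f.map_adj_iff.1 hxy), ⟨⟨f.toEmbedding.optionMap, ?_⟩⟩⟩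
      have hs : ∀ a b c d : W', s(f a, f b) = s(f c, f d) ↔ s(a, b) = s(c, d) := fun a b c d => by
        simp
      rintro (_ | a) (_ | b)
      · exact Iff.rfl
      · change (f b = f x' ∨ f b = f y') ↔ (b = x' ∨ b = y')
        simp
      · change (f a = f x' ∨ f a = f y') ↔ (a = x' ∨ a = y')
        simp
      · change (K.Adj (f a) (f b) ∧ s(f a, f b) ≠ s(f x', f y')) ↔
          (K'.Adj a b ∧ s(a, b) ≠ s(x', y'))
        rw [f.map_adj_iff, Ne, hs]
    · refine ⟨_, _, hK', ⟨⟨f.toEmbedding.trans Function.Embedding.some, ?_⟩⟩⟩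
      intro a b
      change (K.Adj (f a) (f b) ∧ s(f a, f b) ≠ s(x, y)) ↔ K'.Adj a b
      rw [f.map_adj_iff, and_iff_left_iff_imp]
      intro _ h
      rw [Sym2.eq_iff] at h
      rcases h with ⟨h1, h2⟩ | ⟨h1, h2⟩
      · exact hx ⟨⟨a, h1⟩, ⟨b, h2⟩⟩
      · exact hx ⟨⟨b, h2⟩, ⟨a, h1⟩⟩

theorem IsInducedTopologicalMinor.of_isIndContained {U' : Type u} {U V : Type*}
    {H' : SimpleGraph U'} {H : SimpleGraph U} {G : SimpleGraph V} (hH : H'.IsIndContained H)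
    (h : IsInducedTopologicalMinor H G) : IsInducedTopologicalMinor H' G := by
  obtain ⟨W, K, hK, hc⟩ := h
  obtain ⟨W', K', hK', hc'⟩ := hK.exists_of_isIndContained hH
  exact ⟨W', K', hK', hc'.trans hc⟩

/-! ### Generalised theta graphs -/

/-- The generalised theta graph: two branch vertices joined by internally disjoint paths, the
`i`-th of which has `n i` inner vertices. -/
def multiTheta {ι : Type u} (n : ι → ℕ) : SimpleGraph (Bool ⊕ {p : ι × ℕ // p.2 < n p.1}) where
  Adj
    | Sum.inl a, Sum.inl b => a ≠ b ∧ ∃ i, n i = 0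
    | Sum.inl a, Sum.inr p => (a = false ∧ p.1.2 = 0) ∨ (a = true ∧ p.1.2 + 1 = n p.1.1)
    | Sum.inr p, Sum.inl a => (a = false ∧ p.1.2 = 0) ∨ (a = true ∧ p.1.2 + 1 = n p.1.1)
    | Sum.inr p, Sum.inr q => p.1.1 = q.1.1 ∧ (p.1.2 + 1 = q.1.2 ∨ q.1.2 + 1 = p.1.2)
  symm := ⟨by
    rintro (a | p) (b | q) h
    · exact ⟨h.1.symm, h.2⟩
    · exact h
    · exact h
    · exact ⟨h.1.symm, h.2.symm⟩⟩
  loopless := ⟨by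
    rintro (a | p) h
    · exact h.1 rfl
    · have := h.2
      omega⟩

/-- Lengthening a path of a generalised theta graph amounts to subdividing an edge. -/
theorem exists_subdivideEdge_iso_multiTheta {ι : Type u} [DecidableEq ι] (n : ι → ℕ) (i : ι)
    (hi : ∀ j, n j = 0 → n i = 0 → j = i) :
    ∃ x y, (multiTheta n).Adj x y ∧
      Nonempty (multiTheta (Function.update n i (n i + 1)) ≃g
        subdivideEdge (multiTheta n) x y) := by
  have hle : ∀ j, n j ≤ Function.update n i (n i + 1) j := fun j => by
    by_cases h : j = i
    · subst h; simp
    · simp [h]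
  -- The subdivided edge is the last one of path `i`, at the branch vertex `true`, so the new vertex
  -- becomes inner vertex number `n i`.
  let f : Option (Bool ⊕ {p : ι × ℕ // p.2 < n p.1}) →
      Bool ⊕ {p : ι × ℕ // p.2 < Function.update n i (n i + 1) p.1}
    | none => Sum.inr ⟨(i, n i), by simp⟩
    | some (Sum.inl b) => Sum.inl b
    | some (Sum.inr p) => Sum.inr ⟨p.1, p.2.trans_le (hle _)⟩
  have hf : Function.Bijective f := by
    constructor
    · rintro (_ | a | ⟨⟨j, k⟩, hp⟩) (_ | b | ⟨⟨l, m⟩, hq⟩) h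
      · rfl
      · simp [f] at h
      · simp only [f, Sum.inr.injEq, Subtype.mk.injEq, Prod.mk.injEq] at h
        obtain ⟨rfl, rfl⟩ := h
        exact absurd hq (lt_irrefl _)
      · simp [f] at h
      · simpa [f] using h
      · simp [f] at h
      · simp only [f, Sum.inr.injEq, Subtype.mk.injEq, Prod.mk.injEq] at h
        obtain ⟨rfl, rfl⟩ := h
        exact absurd hp (lt_irrefl _)
      · simp [f] at h
      · simpa [f] using h
    · rintro (b | ⟨⟨j, k⟩, hp⟩)
      · exact ⟨some (Sum.inl b), rfl⟩
      · by_cases hk : k < n j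
        · exact ⟨some (Sum.inr ⟨(j, k), hk⟩), rfl⟩
        · refine ⟨none, ?_⟩
          by_cases hj : j = i
          · subst hj
            simp only [Function.update_self] at hp
            obtain rfl : k = n j := by omega
            rfl
          · simp [hj] at hp
            exact absurd hp hk
  obtain ⟨x, hx, hx0⟩ : ∃ x : Bool ⊕ {p : ι × ℕ // p.2 < n p.1},
      (n i = 0 ∧ x = Sum.inl false ∨ ∃ h : n i - 1 < n i, x = Sum.inr ⟨(i, n i - 1), h⟩) ∧
      (multiTheta n).Adj x (Sum.inl true) := by
    by_cases h : n i = 0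
    · exact ⟨_, Or.inl ⟨h, rfl⟩, by simp, i, h⟩
    · exact ⟨_, Or.inr ⟨by omega, rfl⟩, Or.inr ⟨rfl, by simp only; omega⟩⟩
  refine ⟨x, Sum.inl true, hx0, ⟨(RelIso.symm ⟨Equiv.ofBijective f hf, ?_⟩)⟩⟩
  have hupd : ∀ j, Function.update n i (n i + 1) j = if j = i then n i + 1 else n j := fun j => by
    by_cases h : j = i <;> simp [h]
  -- All indices with value 0 stand for one and the same edge. By `hi`, lengthening such an index
  -- leaves no other zero, so the edge really disappears.
  have hz : (∃ j, Function.update n i (n i + 1) j = 0) ↔ (∃ j, n j = 0) ∧ n i ≠ 0 := by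
    constructor
    · rintro ⟨j, hj⟩
      rw [hupd] at hj
      split_ifs at hj with h
      exact ⟨⟨j, hj⟩, fun h0 => h (hi j hj h0)⟩
    · rintro ⟨⟨j, hj⟩, h0⟩
      refine ⟨j, ?_⟩
      rw [hupd, if_neg]
      · exact hj
      · rintro rfl
        exact h0 hj
  rintro (_ | a | ⟨⟨j, k⟩, hp⟩) (_ | b | ⟨⟨l, m⟩, hq⟩)
  · change (i = i ∧ (n i + 1 = n i ∨ n i + 1 = n i)) ↔ False
    simp
  · change ((b = false ∧ n i = 0) ∨ (b = true ∧ n i + 1 = Function.update n i (n i + 1) i)) ↔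
      (Sum.inl b = x ∨ Sum.inl b = Sum.inl true)
    rcases hx with ⟨h0, rfl⟩ | ⟨h0, rfl⟩ <;> cases b <;> simp <;> omega
  · change (i = l ∧ (n i + 1 = m ∨ m + 1 = n i)) ↔
      (Sum.inr _ = x ∨ Sum.inr _ = Sum.inl true)
    simp only at hq
    rcases hx with ⟨h0, rfl⟩ | ⟨h0, rfl⟩
    · simp only [reduceCtorEq, or_self, iff_false, not_and]
      rintro rfl
      omega
    · simp only [Sum.inr.injEq, Subtype.mk.injEq, Prod.mk.injEq, reduceCtorEq, or_false]
      constructor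
      · rintro ⟨rfl, h⟩
        exact ⟨rfl, by omega⟩
      · rintro ⟨rfl, h⟩
        exact ⟨rfl, by omega⟩
  · change ((a = false ∧ n i = 0) ∨ (a = true ∧ n i + 1 = Function.update n i (n i + 1) i)) ↔
      (Sum.inl a = x ∨ Sum.inl a = Sum.inl true)
    rcases hx with ⟨h0, rfl⟩ | ⟨h0, rfl⟩ <;> cases a <;> simp <;> omega
  · change (a ≠ b ∧ ∃ i_1, Function.update n i (n i + 1) i_1 = 0) ↔
      ((a ≠ b ∧ ∃ j, n j = 0) ∧ s(Sum.inl a, Sum.inl b) ≠ s(x, Sum.inl true))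
    rw [hz]
    rcases hx with ⟨h0, rfl⟩ | ⟨h0, rfl⟩
    · cases a <;> cases b <;> simp [h0]
    · have : n i ≠ 0 := by omega
      simp [this]
  · change ((a = false ∧ m = 0) ∨ (a = true ∧ m + 1 = Function.update n i (n i + 1) l)) ↔
      (((a = false ∧ m = 0) ∨ (a = true ∧ m + 1 = n l)) ∧
        s(Sum.inl a, Sum.inr _) ≠ s(x, Sum.inl true))
    simp only at hq
    rw [hupd]
    rcases hx with ⟨h0, rfl⟩ | ⟨h0, rfl⟩
    · by_cases hl : l = i
      · subst hl; omega
      · simp [hl]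
    · by_cases hl : l = i
      · subst hl
        cases a <;> simp <;> omega
      · simp [hl]
  · change (j = i ∧ (k + 1 = n i ∨ n i + 1 = k)) ↔
      (Sum.inr _ = x ∨ Sum.inr _ = Sum.inl true)
    simp only at hp
    rcases hx with ⟨h0, rfl⟩ | ⟨h0, rfl⟩
    · simp only [reduceCtorEq, or_self, iff_false, not_and]
      rintro rfl
      omega
    · simp only [Sum.inr.injEq, Subtype.mk.injEq, Prod.mk.injEq, reduceCtorEq, or_false]
      constructor
      · rintro ⟨rfl, h⟩
        exact ⟨rfl, by omega⟩
      · rintro ⟨rfl, h⟩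
        exact ⟨rfl, by omega⟩
  · change ((b = false ∧ k = 0) ∨ (b = true ∧ k + 1 = Function.update n i (n i + 1) j)) ↔
      (((b = false ∧ k = 0) ∨ (b = true ∧ k + 1 = n j)) ∧
        s(Sum.inr _, Sum.inl b) ≠ s(x, Sum.inl true))
    simp only at hp
    rw [hupd]
    rcases hx with ⟨h0, rfl⟩ | ⟨h0, rfl⟩
    · by_cases hl : j = i
      · subst hl; omega
      · simp [hl]
    · by_cases hl : j = i
      · subst hl
        cases b <;> simp <;> omega
      · simp [hl]
  · change (j = l ∧ (k + 1 = m ∨ m + 1 = k)) ↔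
      ((j = l ∧ (k + 1 = m ∨ m + 1 = k)) ∧ s(Sum.inr _, Sum.inr _) ≠ s(x, Sum.inl true))
    simp

/-- The path lengths are raised one unit at a time, by induction on their sum. Zeros of an
intermediate vector are zeros of `n₀`, so there is never more than one. -/
theorem isIsoSubdivision_multiTheta {ι : Type u} [Finite ι] {n₀ n : ι → ℕ} (hn : n₀ ≤ n)
    (h0 : ∀ i j, n₀ i = 0 → n₀ j = 0 → i = j) :
    IsIsoSubdivision (multiTheta n₀) (multiTheta n) := by
  classical
  have := Fintype.ofFinite ι
  obtain ⟨d, hd⟩ : ∃ d, ∑ i, n i = d := ⟨_, rfl⟩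
  induction d generalizing n with
  | zero =>
    have : n₀ = n := by
      funext i
      have h1 : n₀ i ≤ n i := hn i
      have h2 := Finset.single_le_sum (f := n) (fun _ _ => Nat.zero_le _) (Finset.mem_univ i)
      omega
    subst this
    exact .refl _
  | succ d ih =>
    by_cases hne : n₀ = n
    · subst hne
      exact .refl _
    obtain ⟨i, hi⟩ : ∃ i, n₀ i < n i := by
      by_contra! hcon
      exact hne (le_antisymm hn hcon)
    set n' := Function.update n i (n i - 1) with hn'
    have e1 : Function.update n' i (n' i + 1) = n := by
      rw [hn', Function.update_self, Function.update_idem, Nat.sub_add_cancel (by omega),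
        Function.update_eq_self]
    have e2 : n₀ ≤ n' := fun j => by
      by_cases h : j = i
      · subst h
        simp only [hn', Function.update_self]
        omega
      · simpa [hn', h] using hn j
    have e3 : ∑ i, n' i = d := by
      have h1 := Finset.add_sum_erase Finset.univ n (Finset.mem_univ i)
      have h2 := Finset.add_sum_erase Finset.univ n' (Finset.mem_univ i)
      have h3 : ∑ j ∈ Finset.univ.erase i, n' j = ∑ j ∈ Finset.univ.erase i, n j :=
        Finset.sum_congr rfl fun j hj => by simp [hn', Finset.ne_of_mem_erase hj]
      have h4 : n' i = n i - 1 := by simp [hn']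
      omega
    obtain ⟨x, y, hxy, ⟨e⟩⟩ := exists_subdivideEdge_iso_multiTheta n' i (fun j hj hi' =>
      h0 j i (Nat.le_zero.1 ((e2 j).trans_eq hj)) (Nat.le_zero.1 ((e2 i).trans_eq hi')))
    rw [e1] at e
    exact (ih e2 e3).step hxy e

/-! ### Arcs and joined sets -/

/-- The vertices `p 0, …, p (m - 1)` are the inner vertices of an induced path from `a` to `b`
(where `a` and `b` themselves may be adjacent). -/
structure IsArc {V : Type*} (G : SimpleGraph V) (a b : V) (m : ℕ) (p : ℕ → V) : Prop where
  adj_left : ∀ k < m, G.Adj a (p k) ↔ k = 0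
  adj_right : ∀ k < m, G.Adj b (p k) ↔ k + 1 = m
  adj : ∀ k < m, ∀ l < m, G.Adj (p k) (p l) ↔ k + 1 = l ∨ l + 1 = k
  inj : ∀ k < m, ∀ l < m, p k = p l → k = l
  ne_left : ∀ k < m, p k ≠ a
  ne_right : ∀ k < m, p k ≠ b

theorem multiTheta_isIndContained {ι V : Type*} {G : SimpleGraph V} {a b : V} (hab : a ≠ b)
    {n : ι → ℕ} (p : ι → ℕ → V) (hp : ∀ i, IsArc G a b (n i) (p i))
    (hadj : G.Adj a b ↔ ∃ i, n i = 0)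
    (hdisj : ∀ i j, i ≠ j → ∀ k < n i, ∀ l < n j, p i k ≠ p j l ∧ ¬ G.Adj (p i k) (p j l)) :
    (multiTheta n).IsIndContained G := by
  let f : Bool ⊕ {p : ι × ℕ // p.2 < n p.1} → V
    | Sum.inl x => if x then b else a
    | Sum.inr q => p q.1.1 q.1.2
  have hf : Function.Injective f := by
    rintro (x | ⟨⟨i, k⟩, hk⟩) (y | ⟨⟨j, l⟩, hl⟩) h
    · cases x <;> cases y <;> simp_all [f]
    · cases x
      · exact absurd h.symm ((hp j).ne_left l hl)
      · exact absurd h.symm ((hp j).ne_right l hl)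
    · cases y
      · exact absurd h ((hp i).ne_left k hk)
      · exact absurd h ((hp i).ne_right k hk)
    · by_cases hij : i = j
      · subst hij
        have := (hp i).inj k hk l hl h
        subst this
        rfl
      · exact absurd h (hdisj i j hij k hk l hl).1
  refine ⟨⟨⟨f, hf⟩, ?_⟩⟩
  rintro (x | ⟨⟨i, k⟩, hk⟩) (y | ⟨⟨j, l⟩, hl⟩)
  · change G.Adj (if x then b else a) (if y then b else a) ↔ (x ≠ y ∧ ∃ i, n i = 0)
    rw [← hadj]
    cases x <;> cases y <;> simp [G.adj_comm]
  · change G.Adj (if x then b else a) (p j l) ↔ (x = false ∧ l = 0 ∨ x = true ∧ l + 1 = n j)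
    cases x
    · simpa using (hp j).adj_left l hl
    · simpa using (hp j).adj_right l hl
  · change G.Adj (p i k) (if y then b else a) ↔ (y = false ∧ k = 0 ∨ y = true ∧ k + 1 = n i)
    rw [G.adj_comm]
    cases y
    · simpa using (hp i).adj_left k hk
    · simpa using (hp i).adj_right k hk
  · change G.Adj (p i k) (p j l) ↔ (i = j ∧ (k + 1 = l ∨ l + 1 = k))
    by_cases hij : i = j
    · subst hij
      simpa using (hp i).adj k hk l hl
    · simpa [hij] using (hdisj i j hij k hk l hl).2

/-- There is a walk from `a` to `b` with `m + 1 ≥ 1` inner vertices, all of them in `D`. -/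
def JoinsLength {V : Type*} (G : SimpleGraph V) (D : Set V) (a b : V) (m : ℕ) : Prop :=
  ∃ p : ℕ → V, (∀ k ≤ m, p k ∈ D) ∧ G.Adj a (p 0) ∧ G.Adj b (p m) ∧ ∀ k < m, G.Adj (p k) (p (k + 1))

/-- There is a walk from `a` to `b` through `D`. -/
def Joins {V : Type*} (G : SimpleGraph V) (D : Set V) (a b : V) : Prop :=
  ∃ m, JoinsLength G D a b m

/-- A shortest walk through `D` is an arc: a chord, a repetition or a second neighbour of an end
would allow a shortcut. Length `m` in `JoinsLength` means `m + 1` inner vertices. -/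
theorem Joins.exists_isArc {V : Type*} {G : SimpleGraph V} {D : Set V} {a b : V}
    (h : Joins G D a b) (ha : a ∉ D) (hb : b ∉ D) :
    ∃ m p, 1 ≤ m ∧ IsArc G a b m p ∧ ∀ k < m, p k ∈ D := by
  classical
  obtain ⟨m, ⟨p, hD, h0, hm, hstep⟩, hmin⟩ : ∃ m, JoinsLength G D a b m ∧
      ∀ l < m, ¬ JoinsLength G D a b l := ⟨Nat.find h, Nat.find_spec h, fun l => Nat.find_min h⟩
  have hleft : ∀ k ≤ m, G.Adj a (p k) → k = 0 := by
    intro k hk hadj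
    by_contra hne
    refine hmin (m - k) (by omega) ⟨fun j => p (j + k), fun j hj => hD _ (by omega), ?_, ?_, ?_⟩
    · simpa using hadj
    · simpa [Nat.sub_add_cancel hk] using hm
    · intro j hj
      simp only [show j + 1 + k = j + k + 1 by omega]
      exact hstep _ (by omega)
  have hright : ∀ k ≤ m, G.Adj b (p k) → k = m := by
    intro k hk hadj
    by_contra hne
    exact hmin k (by omega) ⟨p, fun j hj => hD _ (by omega), h0, hadj,
      fun j hj => hstep _ (by omega)⟩
  have hadj : ∀ k l, k < l → l ≤ m → G.Adj (p k) (p l) → k + 1 = l := by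
    intro k l hkl hl hadj
    by_contra hne
    refine hmin (m - (l - k - 1)) (by omega)
      ⟨fun j => if j ≤ k then p j else p (j + (l - k - 1)), fun j hj => ?_, ?_, ?_, ?_⟩
    · dsimp only
      split_ifs <;> exact hD _ (by omega)
    · simpa using h0
    · dsimp only
      rw [if_neg (by omega), Nat.sub_add_cancel (by omega)]
      exact hm
    · intro j hj
      dsimp only
      rcases lt_trichotomy j k with h | rfl | h
      · rw [if_pos h.le, if_pos (by omega)]
        exact hstep _ (by omega)
      · rw [if_pos le_rfl, if_neg (by omega), show j + 1 + (l - j - 1) = l by omega]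
        exact hadj
      · rw [if_neg (by omega), if_neg (by omega),
          show j + 1 + (l - k - 1) = j + (l - k - 1) + 1 by omega]
        exact hstep _ (by omega)
  have hinj : ∀ k l, k < l → l ≤ m → p k ≠ p l := by
    intro k l hkl hl heq
    rcases hl.eq_or_lt with rfl | hlt
    · exact hkl.ne (hright k hkl.le (heq ▸ hm))
    · have := hadj k (l + 1) (by omega) hlt (heq ▸ hstep l hlt)
      omega
  refine ⟨m + 1, p, by omega, ⟨fun k hk => ⟨hleft k (by omega), ?_⟩, fun k hk => ⟨fun h => ?_, ?_⟩,
    fun k hk l hl => ⟨fun h => ?_, ?_⟩, fun k hk l hl h => ?_, fun k hk h => ?_, fun k hk h => ?_⟩,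
    fun k hk => hD k (by omega)⟩
  · rintro rfl
    exact h0
  · rw [hright k (by omega) h]
  · intro h
    rwa [show k = m by omega]
  · rcases lt_trichotomy k l with hkl | rfl | hkl
    · exact Or.inl (hadj k l hkl (by omega) h)
    · exact absurd h (G.loopless.irrefl _)
    · exact Or.inr (hadj l k hkl (by omega) h.symm)
  · rintro (rfl | rfl)
    · exact hstep _ (by omega)
    · exact (hstep _ (by omega)).symm
  · rcases lt_trichotomy k l with hkl | rfl | hkl
    · exact absurd h (hinj k l hkl (by omega))
    · rfl
    · exact absurd h.symm (hinj l k hkl (by omega))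
  · exact ha (h ▸ hD k (by omega))
  · exact hb (h ▸ hD k (by omega))

/-- Pairwise disjoint and anticomplete sets joining `a` and `b` give rise to an induced generalised
theta graph; the indices in `J` stand for the edge `ab`. -/
theorem exists_multiTheta_of_joins {ι V : Type*} {G : SimpleGraph V} {a b : V} (hab : a ≠ b)
    (J : Set ι) (D : ι → Set V) (hJ : G.Adj a b ↔ J.Nonempty)
    (hD : ∀ i, i ∉ J → Joins G (D i) a b ∧ a ∉ D i ∧ b ∉ D i)
    (hdisj : ∀ i j, i ≠ j → i ∉ J → j ∉ J → ∀ x ∈ D i, ∀ y ∈ D j, x ≠ y ∧ ¬ G.Adj x y) :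
    ∃ n : ι → ℕ, (∀ i, n i = 0 ↔ i ∈ J) ∧ (multiTheta n).IsIndContained G := by
  classical
  -- Indices in `J` receive the empty arc, for which every condition is vacuous.
  have h : ∀ i, ∃ m p, (m = 0 ↔ i ∈ J) ∧ IsArc G a b m p ∧ ∀ k < m, p k ∈ D i := fun i => by
    by_cases hi : i ∈ J
    · exact ⟨0, fun _ => a, by simp [hi], by constructor <;> simp, by simp⟩
    · obtain ⟨m, p, hm, hp, hpD⟩ := (hD i hi).1.exists_isArc (hD i hi).2.1 (hD i hi).2.2
      exact ⟨m, p, by simp [hi]; omega, hp, hpD⟩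
  choose n p hn hp hpD using h
  refine ⟨n, hn, multiTheta_isIndContained hab p hp ?_ ?_⟩
  · simp only [hJ, hn]
    rfl
  · intro i j hij k hk l hl
    exact hdisj i j hij (fun h => by have := (hn i).2 h; omega)
      (fun h => by have := (hn j).2 h; omega) _ (hpD i k hk) _ (hpD j l hl)

/-! ### Components of vertex sets -/

theorem exists_seq_of_reflTransGen {α : Type*} {r : α → α → Prop} {u w : α}
    (h : Relation.ReflTransGen r u w) :
    ∃ (m : ℕ) (p : ℕ → α), p 0 = u ∧ p m = w ∧ ∀ k < m, r (p k) (p (k + 1)) := by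
  induction h with
  | refl => exact ⟨0, fun _ => u, rfl, rfl, by simp⟩
  | @tail b c _ hbc ih =>
    obtain ⟨m, p, h0, hm, hp⟩ := ih
    refine ⟨m + 1, fun k => if k ≤ m then p k else c, by simpa using h0, by simp, fun k hk => ?_⟩
    dsimp only
    rcases (Nat.lt_succ_iff.1 hk).eq_or_lt with rfl | h
    · rw [if_pos le_rfl, if_neg (by omega), hm]
      exact hbc
    · rw [if_pos h.le, if_pos (by omega)]
      exact hp k h

/-- The component of `b` in the subgraph induced by `D`. -/
def componentIn {V : Type*} (G : SimpleGraph V) (D : Set V) (b : V) : Set V :=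
  {w | Relation.ReflTransGen (fun u w => u ∈ D ∧ w ∈ D ∧ G.Adj u w) b w}

theorem mem_componentIn_self {V : Type*} (G : SimpleGraph V) (D : Set V) (b : V) :
    b ∈ componentIn G D b := Relation.ReflTransGen.refl

theorem componentIn_subset {V : Type*} {G : SimpleGraph V} {D : Set V} {b : V} (hb : b ∈ D) :
    componentIn G D b ⊆ D := fun w hw => by
  induction hw with
  | refl => exact hb
  | tail _ h _ => exact h.2.1

theorem mem_componentIn_of_adj {V : Type*} {G : SimpleGraph V} {D : Set V} {b u w : V}
    (hb : b ∈ D) (hu : u ∈ componentIn G D b) (hw : w ∈ D) (h : G.Adj u w) :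
    w ∈ componentIn G D b :=
  Relation.ReflTransGen.tail hu ⟨componentIn_subset hb hu, hw, h⟩

theorem joins_componentIn {V : Type*} {G : SimpleGraph V} {D : Set V} {b x y u w : V}
    (hu : u ∈ componentIn G D b) (hw : w ∈ componentIn G D b) (hx : G.Adj x u) (hy : G.Adj y w) :
    Joins G (componentIn G D b) x y := by
  have hsymm : Std.Symm (fun u w => u ∈ D ∧ w ∈ D ∧ G.Adj u w) :=
    ⟨fun u w h => ⟨h.2.1, h.1, h.2.2.symm⟩⟩
  have huw : Relation.ReflTransGen (fun u w => u ∈ D ∧ w ∈ D ∧ G.Adj u w) u w :=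
    Relation.ReflTransGen.trans (Std.Symm.symm _ _ hu) hw
  obtain ⟨m, p, rfl, rfl, hp⟩ := exists_seq_of_reflTransGen huw
  refine ⟨m, p, fun k hk => ?_, hx, hy, fun k hk => (hp k hk).2.2⟩
  induction k with
  | zero => exact hu
  | succ k ih => exact Relation.ReflTransGen.tail (ih (by omega)) (hp k (by omega))

theorem Joins.symm {V : Type*} {G : SimpleGraph V} {D : Set V} {a b : V} (h : Joins G D a b) :
    Joins G D b a := by
  obtain ⟨m, p, hD, ha, hb, hp⟩ := h
  refine ⟨m, fun k => p (m - k), fun k _ => hD _ (by omega), by simpa using hb, by simpa using ha,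
    fun k hk => ?_⟩
  have := hp (m - (k + 1)) (by omega)
  rw [show m - (k + 1) + 1 = m - k by omega] at this
  exact this.symm

theorem joins_singleton {V : Type*} {G : SimpleGraph V} {a b d : V} (ha : G.Adj a d)
    (hb : G.Adj b d) : Joins G {d} a b :=
  ⟨0, fun _ => d, by simp, ha, hb, by simp⟩

/-! ### Clique separations -/

/-- A separation of `G` along a clique, both of whose sides are proper. -/
structure IsCliqueSeparation {V : Type*} (G : SimpleGraph V) (A B : Set V) : Prop where
  union : A ∪ B = Set.univ
  clique : G.IsClique (A ∩ B)
  not_adj : ∀ x ∈ A, x ∉ B → ∀ y ∈ B, y ∉ A → ¬ G.Adj x y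
  left_ne : A ≠ Set.univ
  right_ne : B ≠ Set.univ

/-- A hereditary property whose clique-inseparable members have tree decompositions with bags of
size at most `k` consists of graphs with such a decomposition. -/
theorem hasTreeDecomposition_of_atoms {k : ℕ} (P : ∀ V : Type v, SimpleGraph V → Prop)
    (hP : ∀ (V : Type v) (G : SimpleGraph V) (s : Set V), P V G → P s (G.induce s))
    (hatom : ∀ (V : Type v) [Finite V] (G : SimpleGraph V), P V G →
      (∀ A B, ¬ IsCliqueSeparation G A B) → HasTreeDecomposition G k)
    (V : Type v) [Finite V] (G : SimpleGraph V) (hG : P V G) : HasTreeDecomposition G k := by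
  obtain ⟨N, hN⟩ : ∃ N, Nat.card V = N := ⟨_, rfl⟩
  induction N using Nat.strong_induction_on generalizing V with
  | _ N ih =>
    -- Induction on the number of vertices: both sides of a clique separation are proper, hence
    -- smaller.
    by_cases h : ∀ A B, ¬ IsCliqueSeparation G A B
    · exact hatom V G hG h
    · push Not at h
      obtain ⟨A, B, hAB⟩ := h
      have hcard : ∀ s : Set V, s ≠ Set.univ → Nat.card s < N := fun s hs => by
        rw [← hN, Nat.card_coe_set_eq, ← Set.ncard_univ]
        exact Set.ncard_lt_ncard (Set.ssubset_univ_iff.2 hs)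
      exact HasTreeDecomposition.glue hAB.union hAB.clique hAB.not_adj
        (ih _ (hcard A hAB.left_ne) A _ (hP V G A hG) rfl)
        (ih _ (hcard B hAB.right_ne) B _ (hP V G B hG) rfl)

/-- Two nonadjacent vertices are separated by a clique, or there is a hole, which consists of a
vertex `a`, two nonadjacent neighbours `x` and `y` of `a`, and an arc between them. -/
theorem exists_isCliqueSeparation_or_hole {V : Type*} {G : SimpleGraph V} {a b : V} (hab : a ≠ b)
    (h : ¬ G.Adj a b) :
    (∃ A B, IsCliqueSeparation G A B) ∨
      ∃ (a x y : V) (m : ℕ) (p : ℕ → V), 1 ≤ m ∧ x ≠ y ∧ ¬ G.Adj x y ∧ G.Adj a x ∧ G.Adj a y ∧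
        IsArc G x y m p ∧ ∀ k < m, p k ≠ a ∧ ¬ G.Adj a (p k) := by
  set D : Set V := {w | w ≠ a ∧ ¬ G.Adj a w} with hD
  have hbD : b ∈ D := ⟨hab.symm, h⟩
  set B := componentIn G D b with hB
  have hBD : B ⊆ D := componentIn_subset hbD
  set S : Set V := {s | s ∉ B ∧ ∃ w ∈ B, G.Adj s w} with hS
  have hSa : ∀ s ∈ S, G.Adj a s := by
    rintro s ⟨hs, w, hw, hsw⟩
    by_contra hcon
    apply hs
    refine mem_componentIn_of_adj hbD hw ⟨?_, hcon⟩ hsw.symm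
    rintro rfl
    exact (hBD hw).2 hsw
  -- If `S` is a clique, it separates `a` from `b`. If not, two nonadjacent vertices of `S` are
  -- joined by an arc through `B`, and `a` closes it to a hole.
  by_cases hclique : G.IsClique S
  · left
    refine ⟨B ∪ S, Bᶜ, ?_, ?_, ?_, ?_, ?_⟩
    · ext x
      by_cases hx : x ∈ B <;> simp [hx]
    · refine hclique.subset ?_
      rintro x ⟨hx | hx, hx'⟩
      · exact absurd hx hx'
      · exact hx
    · rintro x - hx y hy hy' hxy
      rw [Set.mem_compl_iff, not_not] at hx
      exact hy' (Or.inr ⟨hy, x, hx, hxy.symm⟩)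
    · intro hu
      have : a ∈ B ∪ S := hu ▸ Set.mem_univ a
      rcases this with ha | ha
      · exact (hBD ha).1 rfl
      · exact G.loopless.irrefl _ (hSa a ha)
    · intro hu
      have : b ∈ Bᶜ := hu ▸ Set.mem_univ b
      exact this (mem_componentIn_self G D b)
  · right
    rw [IsClique, Set.Pairwise] at hclique
    push Not at hclique
    obtain ⟨x, hx, y, hy, hxy, hadj⟩ := hclique
    obtain ⟨hxB, u, hu, hxu⟩ := id hx
    obtain ⟨hyB, w, hw, hyw⟩ := id hy
    obtain ⟨m, p, hm, hp, hpB⟩ := (joins_componentIn hu hw hxu hyw).exists_isArc hxB hyB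
    exact ⟨a, x, y, m, p, hm, hxy, hadj, hSa x hx, hSa y hy, hp, fun k hk => hBD (hpB k hk)⟩

/-! ### Graphs without holes -/

theorem exists_not_adj_of_card_lt {V : Type*} [Finite V] {G : SimpleGraph V} {k : ℕ}
    (hk : ∀ s : Finset V, G.IsClique s → s.card ≤ k) (h : k < Nat.card V) :
    ∃ a b, a ≠ b ∧ ¬ G.Adj a b := by
  have := Fintype.ofFinite V
  by_contra! hcon
  have := hk Finset.univ fun a _ b _ hab => hcon a b hab
  rw [Finset.card_univ, ← Nat.card_eq_fintype_card] at this
  omega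

theorem isClique_map_induce {V : Type*} {G : SimpleGraph V} {s : Set V} {k : ℕ}
    (hk : ∀ t : Finset V, G.IsClique t → t.card ≤ k) (t : Finset s)
    (ht : (G.induce s).IsClique t) : t.card ≤ k := by
  rw [← Finset.card_map (Function.Embedding.subtype _)]
  apply hk
  intro x hx y hy hxy
  simp only [Finset.coe_map, Set.mem_image, Finset.mem_coe] at hx hy
  obtain ⟨x, hx, rfl⟩ := hx
  obtain ⟨y, hy, rfl⟩ := hy
  exact ht hx hy (fun e => hxy (by rw [e]))

theorem induce_isIndContained {V : Type*} (G : SimpleGraph V) (s : Set V) :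
    (G.induce s).IsIndContained G := ⟨Embedding.induce s⟩

/-- A chordal graph has a tree decomposition whose bags are at most as large as its cliques. -/
theorem hasTreeDecomposition_of_no_hole {V : Type v} [Finite V] {G : SimpleGraph V} {k : ℕ}
    (hk : ∀ s : Finset V, G.IsClique s → s.card ≤ k)
    (hG : ∀ n : Fin 2 → ℕ, (∀ i, n i ≠ 0) → ¬ (multiTheta n).IsIndContained G) :
    HasTreeDecomposition G k := by
  refine hasTreeDecomposition_of_atoms (k := k)
    (fun V G => (∀ s : Finset V, G.IsClique s → s.card ≤ k) ∧
      ∀ n : Fin 2 → ℕ, (∀ i, n i ≠ 0) → ¬ (multiTheta n).IsIndContained G)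
    (fun V G s h => ⟨isClique_map_induce h.1, fun n hn hc =>
      h.2 n hn (hc.trans (induce_isIndContained G s))⟩) ?_ V G ⟨hk, hG⟩
  intro V _ G ⟨hk, hG⟩ hsep
  refine hasTreeDecomposition_of_card_le G (not_lt.1 fun hlt => ?_)
  obtain ⟨a, b, hab, hadj⟩ := exists_not_adj_of_card_lt hk hlt
  rcases exists_isCliqueSeparation_or_hole hab hadj with ⟨A, B, hAB⟩ |
    ⟨a, x, y, m, p, hm, hxy, hnadj, hax, hay, hp, hpa⟩
  · exact hsep A B hAB
  -- The hole is a theta graph with branch vertices `x` and `y` and two paths: the arc and the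
  -- single vertex `a`.
  · refine hG ![m, 1] (by intro i; fin_cases i <;> simp; omega)
      (multiTheta_isIndContained hxy ![p, fun _ => a] ?_ ?_ ?_)
    · intro i
      fin_cases i
      · exact hp
      · constructor <;> simp [hax.symm, hay.symm, hax.ne, hay.ne]
    · simp [hnadj, Fin.exists_fin_two]
      omega
    · intro i j hij k hk l hl
      fin_cases i <;> fin_cases j
      · simp at hij
      · exact ⟨(hpa k hk).1, fun h => (hpa k hk).2 h.symm⟩
      · exact ⟨(hpa l hl).1.symm, (hpa l hl).2⟩
      · simp at hij

/-! ### Holes in graphs without induced theta graphs -/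

/-- The vertices `c 0, …, c (N - 1)` form an induced cycle of length `N ≥ 4`. -/
structure IsHole {V : Type*} (G : SimpleGraph V) (N : ℕ) (c : ℕ → V) : Prop where
  four_le : 4 ≤ N
  inj : ∀ i < N, ∀ j < N, c i = c j → i = j
  adj : ∀ i < N, ∀ j < N, G.Adj (c i) (c j) ↔
    i + 1 = j ∨ j + 1 = i ∨ (i = 0 ∧ j + 1 = N) ∨ (j = 0 ∧ i + 1 = N)

/-- The cyclic order is `a`, `x`, `p 0`, …, `p (m - 1)`, `y`, which makes `m + 3` vertices. -/
theorem isHole_of_isArc {V : Type*} {G : SimpleGraph V} {a x y : V} {m : ℕ} {p : ℕ → V}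
    (hm : 1 ≤ m) (hxy : x ≠ y) (hnadj : ¬ G.Adj x y) (hax : G.Adj a x) (hay : G.Adj a y)
    (hp : IsArc G x y m p) (hpa : ∀ k < m, p k ≠ a ∧ ¬ G.Adj a (p k)) :
    IsHole G (m + 3)
      (fun i => if i = 0 then a else if i = 1 then x else if i = m + 2 then y else p (i - 2)) := by
  set c : ℕ → V :=
    fun i => if i = 0 then a else if i = 1 then x else if i = m + 2 then y else p (i - 2) with hc
  have c0 : c 0 = a := by simp [hc]
  have c1 : c 1 = x := by simp [hc]
  have cy : c (m + 2) = y := by simp [hc]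
  have ck : ∀ k < m, c (k + 2) = p k := fun k hk => by simp [hc, hk.ne]
  have hcases : ∀ i < m + 3, i = 0 ∨ i = 1 ∨ i = m + 2 ∨ ∃ k < m, i = k + 2 := fun i hi => by
    by_cases h : i < 2 ∨ i = m + 2
    · omega
    · exact Or.inr (Or.inr (Or.inr ⟨i - 2, by omega, by omega⟩))
  have key : ∀ i j, i < j → j < m + 3 → c i ≠ c j ∧
      (G.Adj (c i) (c j) ↔ i + 1 = j ∨ (i = 0 ∧ j + 1 = m + 3)) := by
    intro i j hij hj
    rcases hcases i (by omega) with rfl | rfl | rfl | ⟨k, hk, rfl⟩ <;>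
      rcases hcases j hj with rfl | rfl | rfl | ⟨l, hl, rfl⟩
    any_goals omega
    · rw [c0, c1]
      exact ⟨hax.ne, iff_of_true hax (by omega)⟩
    · rw [c0, cy]
      exact ⟨hay.ne, iff_of_true hay (by omega)⟩
    · rw [c0, ck l hl]
      exact ⟨(hpa l hl).1.symm, iff_of_false (hpa l hl).2 (by omega)⟩
    · rw [c1, cy]
      exact ⟨hxy, iff_of_false hnadj (by omega)⟩
    · rw [c1, ck l hl, hp.adj_left l hl]
      exact ⟨(hp.ne_left l hl).symm, by omega⟩
    · rw [cy, ck k hk, G.adj_comm, hp.adj_right k hk]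
      exact ⟨hp.ne_right k hk, by omega⟩
    · rw [ck k hk, ck l hl, hp.adj k hk l hl]
      exact ⟨fun e => by have := hp.inj k hk l hl e; omega, by omega⟩
  refine ⟨by omega, fun i hi j hj e => ?_, fun i hi j hj => ?_⟩
  · rcases lt_trichotomy i j with h | h | h
    · exact absurd e (key i j h hj).1
    · exact h
    · exact absurd e.symm (key j i h hi).1
  · rcases lt_trichotomy i j with h | rfl | h
    · rw [(key i j h hj).2]
      omega
    · simp only [SimpleGraph.irrefl, false_iff]
      omega
    · rw [G.adj_comm, (key j i h hi).2]
      omega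

/-- `G` has no induced subdivision of the diamond. -/
def ThetaFree {V : Type*} (G : SimpleGraph V) : Prop :=
  ∀ n : Fin 3 → ℕ, n 1 ≠ 0 → n 2 ≠ 0 → ¬ (multiTheta n).IsIndContained G

/-- The edge `ab` itself serves as the path of index 0, the only one that may lack inner vertices.
-/
theorem not_thetaFree_of_adj {V : Type*} {G : SimpleGraph V} {a b : V} (hab : G.Adj a b)
    {D₁ D₂ : Set V} (h₁ : Joins G D₁ a b) (h₂ : Joins G D₂ a b) (ha₁ : a ∉ D₁) (hb₁ : b ∉ D₁)
    (ha₂ : a ∉ D₂) (hb₂ : b ∉ D₂) (hdisj : ∀ x ∈ D₁, ∀ y ∈ D₂, x ≠ y ∧ ¬ G.Adj x y) :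
    ¬ ThetaFree G := by
  obtain ⟨n, hn, hc⟩ := exists_multiTheta_of_joins (G := G) hab.ne ({0} : Set (Fin 3)) ![∅, D₁, D₂]
    (by simp [hab]) (by
      intro i hi
      fin_cases i
      · simp at hi
      · exact ⟨h₁, ha₁, hb₁⟩
      · exact ⟨h₂, ha₂, hb₂⟩) (by
      intro i j hij hi hj x hx y hy
      fin_cases i <;> fin_cases j <;> first
        | exact absurd rfl hij
        | exact absurd rfl hi
        | exact absurd rfl hj
        | exact hdisj x hx y hy
        | exact ⟨(hdisj y hy x hx).1.symm, fun h => (hdisj y hy x hx).2 h.symm⟩)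
  exact fun hG => hG n (by simp [hn]) (by simp [hn]) hc

theorem not_thetaFree_of_not_adj {V : Type*} {G : SimpleGraph V} {a b : V} (hne : a ≠ b)
    (hab : ¬ G.Adj a b) {D : Fin 3 → Set V} (h : ∀ i, Joins G (D i) a b) (ha : ∀ i, a ∉ D i)
    (hb : ∀ i, b ∉ D i) (hdisj : ∀ i j, i < j → ∀ x ∈ D i, ∀ y ∈ D j, x ≠ y ∧ ¬ G.Adj x y) :
    ¬ ThetaFree G := by
  obtain ⟨n, hn, hc⟩ := exists_multiTheta_of_joins hne ∅ D (by simp [hab])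
    (fun i _ => ⟨h i, ha i, hb i⟩) (by
      intro i j hij _ _ x hx y hy
      rcases hij.lt_or_gt with hij | hij
      · exact hdisj i j hij x hx y hy
      · have := hdisj j i hij y hy x hx
        exact ⟨this.1.symm, fun h => this.2 h.symm⟩)
  exact fun hG => hG n (by simp [hn]) (by simp [hn]) hc

/-- Any chosen vertex of a hole may thus be assumed to have index 0. -/
theorem IsHole.rotate {V : Type*} {G : SimpleGraph V} {N : ℕ} {c : ℕ → V} (hc : IsHole G N c)
    {r : ℕ} (hr : r < N) : IsHole G N (fun i => c (if i + r < N then i + r else i + r - N)) := by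
  have h4 := hc.four_le
  refine ⟨hc.four_le, fun i hi j hj h => ?_, fun i hi j hj => ?_⟩
  · have := hc.inj _ (by split_ifs <;> omega) _ (by split_ifs <;> omega) h
    split_ifs at this <;> omega
  · rw [hc.adj _ (by split_ifs <;> omega) _ (by split_ifs <;> omega)]
    split_ifs <;> omega

/-- A segment of a hole joins the neighbours of its ends. -/
theorem IsHole.joins_segment {V : Type*} {G : SimpleGraph V} {N : ℕ} {c : ℕ → V}
    (hc : IsHole G N c) {l u : ℕ} (hlu : l ≤ u) (hu : u < N) {a b : V} (ha : G.Adj a (c l))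
    (hb : G.Adj b (c u)) : Joins G {x | ∃ k, l ≤ k ∧ k ≤ u ∧ x = c k} a b := by
  refine ⟨u - l, fun k => c (l + k), fun k hk => ⟨_, by omega, by omega, rfl⟩, ha, ?_,
    fun k hk => ?_⟩
  · simpa [Nat.add_sub_cancel' hlu] using hb
  · rw [hc.adj _ (by omega) _ (by omega)]
    exact Or.inl rfl

/-- A hole with an ear gives rise to an induced theta graph. -/
theorem IsHole.not_thetaFree_of_ear {V : Type*} {G : SimpleGraph V} {N : ℕ} {c : ℕ → V}
    (hc : IsHole G N c) {D : Set V} (hD : ∀ i < N, c i ∉ D) {i j : ℕ} (hi : i < N) (hj : j < N)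
    (hij : i ≠ j) (hjoin : Joins G D (c i) (c j))
    (hatt : ∀ d ∈ D, ∀ k < N, G.Adj d (c k) → k = i ∨ k = j) : ¬ ThetaFree G := by
  wlog h0 : i = 0 generalizing c i j
  · have e1 : c (if 0 + i < N then 0 + i else 0 + i - N) = c i := by
      rw [if_pos (by omega), Nat.zero_add]
    set j' := if i ≤ j then j - i else j + N - i with hj'
    have e2 : c (if j' + i < N then j' + i else j' + i - N) = c j := by
      congr 1
      split_ifs at hj' ⊢ <;> omega
    refine this (hc.rotate hi) (fun k hk => hD _ (by split_ifs <;> omega)) (i := 0) (j := j')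
      (by omega) (by split_ifs at hj' <;> omega) (by split_ifs at hj' <;> omega)
      (by rwa [e1, e2]) (fun d hd k hk hadj => ?_) rfl
    have := hatt d hd _ (by split_ifs <;> omega) hadj
    split_ifs at hj' this <;> omega
  subst h0
  have h4 := hc.four_le
  have hdis : ∀ k < N, k ≠ 0 → k ≠ j → ∀ d ∈ D, c k ≠ d ∧ ¬ G.Adj (c k) d := fun k hk h0 h1 d hd =>
    ⟨fun e => hD k hk (e ▸ hd), fun h => by
      have := hatt d hd k hk h.symm
      omega⟩
  have hseg : ∀ k < N, ∀ l u, u < N → (k < l ∨ u < k) →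
      c k ∉ {x | ∃ k, l ≤ k ∧ k ≤ u ∧ x = c k} := by
    rintro k hk l u hu hk' ⟨t, ht, ht', he⟩
    have := hc.inj k hk t (by omega) he
    omega
  -- If the ends of the ear are consecutive on the hole (`j = 1` or `j = N - 1`), the three paths
  -- are their edge, the rest of the hole and the ear. Otherwise they are the two segments of the
  -- hole and the ear.
  by_cases hj1 : j = 1
  · subst hj1
    refine not_thetaFree_of_adj ((hc.adj _ hi _ hj).2 (by omega))
      ((hc.joins_segment (l := 2) (u := N - 1) (by omega) (by omega)
        ((hc.adj 1 hj _ (by omega)).2 (by omega)) ((hc.adj 0 hi _ (by omega)).2 (by omega))).symm)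
      hjoin (hseg _ hi _ _ (by omega) (by omega)) (hseg _ hj _ _ (by omega) (by omega))
      (hD _ hi) (hD _ hj) ?_
    rintro _ ⟨k, hk, hk', rfl⟩ d hd
    exact hdis k (by omega) (by omega) (by omega) d hd
  by_cases hj2 : j + 1 = N
  · refine not_thetaFree_of_adj ((hc.adj _ hi _ hj).2 (by omega))
      (hc.joins_segment (l := 1) (u := N - 2) (by omega) (by omega)
        ((hc.adj 0 hi _ (by omega)).2 (by omega)) ((hc.adj j hj _ (by omega)).2 (by omega)))
      hjoin (hseg _ hi _ _ (by omega) (by omega)) (hseg _ hj _ _ (by omega) (by omega))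
      (hD _ hi) (hD _ hj) ?_
    rintro _ ⟨k, hk, hk', rfl⟩ d hd
    exact hdis k (by omega) (by omega) (by omega) d hd
  have j1 := hc.joins_segment (l := 1) (u := j - 1) (by omega) (by omega)
        ((hc.adj 0 hi _ (by omega)).2 (by omega)) ((hc.adj j hj _ (by omega)).2 (by omega))
  have j2 := (hc.joins_segment (l := j + 1) (u := N - 1) (by omega) (by omega)
        ((hc.adj j hj _ (by omega)).2 (by omega)) ((hc.adj 0 hi _ (by omega)).2 (by omega))).symm
  refine not_thetaFree_of_not_adj (a := c 0) (b := c j) (fun e => hij (hc.inj _ hi _ hj e))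
    (fun h => by rw [hc.adj _ hi _ hj] at h; omega) (D := ![{x | ∃ k, 1 ≤ k ∧ k ≤ j - 1 ∧ x = c k},
      {x | ∃ k, j + 1 ≤ k ∧ k ≤ N - 1 ∧ x = c k}, D]) ?_ ?_ ?_ ?_
  · intro t
    fin_cases t
    exacts [j1, j2, hjoin]
  · intro t
    fin_cases t
    exacts [hseg _ hi _ _ (by omega) (by omega), hseg _ hi _ _ (by omega) (by omega), hD _ hi]
  · intro t
    fin_cases t
    exacts [hseg _ hj _ _ (by omega) (by omega), hseg _ hj _ _ (by omega) (by omega), hD _ hj]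
  · intro s t hst x hx y hy
    fin_cases s <;> fin_cases t
    all_goals first | exact absurd hst (by decide) | skip
    · obtain ⟨k, hk, hk', rfl⟩ := hx
      obtain ⟨l, hl, hl', rfl⟩ := hy
      refine ⟨fun e => ?_, fun h => ?_⟩
      · have := hc.inj k (by omega) l (by omega) e
        omega
      · rw [hc.adj k (by omega) l (by omega)] at h
        omega
    · obtain ⟨k, hk, hk', rfl⟩ := hx
      exact hdis k (by omega) (by omega) (by omega) y hy
    · obtain ⟨k, hk, hk', rfl⟩ := hx
      exact hdis k (by omega) (by omega) (by omega) y hy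

/-- In a graph without induced theta graphs, a vertex outside a hole has at most one neighbour on
the hole. -/
theorem IsHole.eq_of_adj_of_adj {V : Type*} {G : SimpleGraph V} {N : ℕ} {c : ℕ → V}
    (hG : ThetaFree G) (hc : IsHole G N c) {v : V} (hv : ∀ i < N, c i ≠ v) {i j : ℕ} (hi : i < N)
    (hj : j < N) (hvi : G.Adj v (c i)) (hvj : G.Adj v (c j)) : i = j := by
  classical
  by_contra hij
  wlog h0 : i = 0 generalizing c i j
  · have e1 : c (if 0 + i < N then 0 + i else 0 + i - N) = c i := by
      rw [if_pos (by omega), Nat.zero_add]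
    set j' := if i ≤ j then j - i else j + N - i with hj'
    have e2 : c (if j' + i < N then j' + i else j' + i - N) = c j := by
      congr 1
      split_ifs at hj' ⊢ <;> omega
    exact this (hc.rotate hi) (fun k hk => hv _ (by split_ifs <;> omega)) (i := 0) (j := j')
      (by omega) (by split_ifs at hj' <;> omega) (by rwa [e1]) (by rwa [e2])
      (by split_ifs at hj' <;> omega) rfl
  subst h0
  have h4 := hc.four_le
  -- Besides `c 0`, let `c s` be the first and `c t` the last neighbour of `v` on the hole. If `s =
  -- t`, then `v` alone is an ear.
  obtain ⟨s, ⟨hs0, hsN, hs⟩, hsmin⟩ : ∃ s, (0 < s ∧ s < N ∧ G.Adj v (c s)) ∧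
      ∀ l < s, ¬ (0 < l ∧ l < N ∧ G.Adj v (c l)) := by
    have h : ∃ s, 0 < s ∧ s < N ∧ G.Adj v (c s) := ⟨j, by omega, hj, hvj⟩
    exact ⟨Nat.find h, Nat.find_spec h, fun l => Nat.find_min h⟩
  obtain ⟨t, htN, ht, htmax⟩ : ∃ t < N, G.Adj v (c t) ∧ ∀ l, t < l → l < N → ¬ G.Adj v (c l) := by
    have h : ∃ d, d < N ∧ G.Adj v (c (N - 1 - d)) :=
      ⟨N - 1 - s, by omega, by rwa [show N - 1 - (N - 1 - s) = s by omega]⟩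
    refine ⟨N - 1 - Nat.find h, by omega, (Nat.find_spec h).2, fun l hl hlN hadj => ?_⟩
    exact Nat.find_min h (m := N - 1 - l) (by omega)
      ⟨by omega, by rwa [show N - 1 - (N - 1 - l) = l by omega]⟩
  have hst : s ≤ t := not_lt.1 fun h => htmax s h hsN hs
  have hvseg : ∀ l u, u < N → v ∉ {x | ∃ k, l ≤ k ∧ k ≤ u ∧ x = c k} := by
    rintro l u hu ⟨k, hk, hk', e⟩
    exact hv k (by omega) e.symm
  have hseg : ∀ k < N, ∀ l u, u < N → (k < l ∨ u < k) →
      c k ∉ {x | ∃ k, l ≤ k ∧ k ≤ u ∧ x = c k} := by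
    rintro k hk l u hu hk' ⟨t, ht, ht', he⟩
    have := hc.inj k hk t (by omega) he
    omega
  have hpair : ∀ k < N, ∀ l < N, k + 1 < l → (k = 0 → l + 1 < N) →
      c k ≠ c l ∧ ¬ G.Adj (c k) (c l) := by
    intro k hk l hl h1 h2
    refine ⟨fun e => ?_, fun h => ?_⟩
    · have := hc.inj k hk l hl e
      omega
    · rw [hc.adj k hk l hl] at h
      omega
  rcases hst.eq_or_lt with rfl | hlt
  · refine hc.not_thetaFree_of_ear (D := {v}) (fun k hk h => hv k hk h) hi hsN hs0.ne
      (joins_singleton hvi.symm hs.symm) ?_ hG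
    rintro d rfl k hk hadj
    by_contra hcon
    push Not at hcon
    rcases lt_trichotomy k s with h | h | h
    · exact hsmin k h ⟨by omega, hk, hadj⟩
    · exact hcon.2 h
    · exact htmax k h hk hadj
  -- Here the edge from `c 0` to `v` and the segments from 1 to `s` and from `t` to `N - 1` form a
  -- theta graph, the gap keeping the segments anticomplete.
  by_cases hgap : s + 1 < t
  · refine not_thetaFree_of_adj (a := c 0) (b := v) hvi.symm
      (hc.joins_segment hs0 hsN ((hc.adj 0 hi 1 (by omega)).2 (by omega)) hs)
      (hc.joins_segment (l := t) (u := N - 1) (by omega) (by omega) ht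
        ((hc.adj 0 hi _ (by omega)).2 (by omega))).symm
      (hseg _ hi _ _ hsN (by omega)) (hvseg _ _ hsN) (hseg _ hi _ _ (by omega) (by omega))
      (hvseg _ _ (by omega)) ?_ hG
    rintro _ ⟨k, hk, hk', rfl⟩ _ ⟨l, hl, hl', rfl⟩
    exact hpair k (by omega) l (by omega) (by omega) (by omega)
  obtain rfl : t = s + 1 := by omega
  -- Now `c s` and `c (s + 1)` are the only neighbours besides `c 0`. One of their edges to `v` is
  -- the edge of the theta graph. The extreme cases, where `c 0` is adjacent to one of the two, are
  -- treated apart.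
  by_cases hs1 : s = 1
  · subst hs1
    refine not_thetaFree_of_adj hs
      (joins_singleton hvi ((hc.adj 1 hsN 0 hi).2 (by omega)))
      (joins_singleton ht ((hc.adj 1 hsN (1 + 1) htN).2 (by omega)))
      (fun h => hv _ hi h.symm) (fun h => by have := hc.inj _ hsN _ hi h; omega)
      (fun h => hv _ htN h.symm) (fun h => by have := hc.inj _ hsN _ htN h; omega) ?_ hG
    rintro _ rfl _ rfl
    exact hpair 0 hi _ htN (by omega) (by omega)
  by_cases htl : s + 1 + 1 = N
  · refine not_thetaFree_of_adj ht
      (joins_singleton hvi ((hc.adj _ htN 0 hi).2 (by omega)))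
      (joins_singleton hs ((hc.adj _ htN s hsN).2 (by omega)))
      (fun h => hv _ hi h.symm) (fun h => by have := hc.inj _ htN _ hi h; omega)
      (fun h => hv _ hsN h.symm) (fun h => by have := hc.inj _ htN _ hsN h; omega) ?_ hG
    rintro _ rfl _ rfl
    exact hpair 0 hi _ hsN (by omega) (by omega)
  · refine not_thetaFree_of_adj hs
      (hc.joins_segment (l := 0) (u := s - 1) (by omega) (by omega) hvi
        ((hc.adj s hsN _ (by omega)).2 (by omega)))
      (joins_singleton ht ((hc.adj _ hsN _ htN).2 (by omega)))
      (hvseg _ _ (by omega)) (hseg _ hsN _ _ (by omega) (by omega))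
      (fun h => hv _ htN h.symm) (fun h => by have := hc.inj _ hsN _ htN h; omega) ?_ hG
    rintro _ ⟨k, hk, hk', rfl⟩ _ rfl
    exact hpair k (by omega) _ htN (by omega) (by omega)

/-- In a clique-inseparable graph without induced theta graphs, a hole is the whole graph. -/
theorem IsHole.exists_eq {V : Type*} {G : SimpleGraph V} {N : ℕ} {c : ℕ → V}
    (hG : ThetaFree G) (hc : IsHole G N c) (hsep : ∀ A B, ¬ IsCliqueSeparation G A B) (v : V) :
    ∃ i < N, c i = v := by
  classical
  by_contra! hv
  have h4 := hc.four_le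
  set R : Set V := {w | ∀ i < N, c i ≠ w} with hR
  set D := componentIn G R v with hD
  have hDR : D ⊆ R := componentIn_subset hv
  -- A component `D` off the hole that attaches to at most one hole vertex is cut off by a clique of
  -- size at most one.
  by_cases hT : ∀ i < N, ∀ j < N, (∃ d ∈ D, G.Adj (c i) d) → (∃ d ∈ D, G.Adj (c j) d) → i = j
  · set T : Set V := {w | ∃ i < N, c i = w ∧ ∃ d ∈ D, G.Adj w d} with hTdef
    refine hsep (D ∪ T) Dᶜ ⟨?_, ?_, ?_, ?_, ?_⟩
    · ext x
      by_cases hx : x ∈ D <;> simp [hx]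
    · rintro x ⟨hx | ⟨i, hi, rfl, hd⟩, hx'⟩ y ⟨hy | ⟨j, hj, rfl, hd'⟩, hy'⟩ hxy
      · exact absurd hx hx'
      · exact absurd hx hx'
      · exact absurd hy hy'
      · exact absurd (by rw [hT i hi j hj hd hd']) hxy
    · rintro x - hx y hy hy' hxy
      rw [Set.mem_compl_iff, not_not] at hx
      by_cases hyR : y ∈ R
      · exact hy (mem_componentIn_of_adj hv hx hyR hxy)
      · simp only [hR, Set.mem_ofPred_eq, not_forall, not_not] at hyR
        obtain ⟨i, hi, he⟩ := hyR
        exact hy' (Or.inr ⟨i, hi, he, x, hx, hxy.symm⟩)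
    · intro hu
      have hmem : ∀ i < N, ∃ d ∈ D, G.Adj (c i) d := fun i hi => by
        have : c i ∈ D ∪ T := hu ▸ Set.mem_univ _
        rcases this with h | ⟨-, -, -, h⟩
        · exact absurd rfl (hDR h i hi)
        · exact h
      have := hT 0 (by omega) 1 (by omega) (hmem _ (by omega)) (hmem _ (by omega))
      omega
    · intro hu
      have : v ∈ Dᶜ := hu ▸ Set.mem_univ v
      exact this (mem_componentIn_self G R v)
  · push Not at hT
    obtain ⟨i, hi, j, hj, ⟨d, hd, hid⟩, ⟨d', hd', hjd⟩, hij⟩ := hT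
    -- A shortest connection off the hole between any two distinct hole vertices is an ear. By
    -- minimality only its last vertex can see a hole vertex other than `c i`, and that vertex has
    -- just one neighbour on the hole.
    have hex : ∃ m, ∃ i < N, ∃ j < N, i ≠ j ∧ JoinsLength G R (c i) (c j) m := by
      obtain ⟨m, p, hp, h⟩ := joins_componentIn hd hd' hid hjd
      exact ⟨m, i, hi, j, hj, hij, p, fun k hk => hDR (hp k hk), h⟩
    obtain ⟨i, hi, j, hj, hij, p, hpR, hp0, hpm, hp⟩ := Nat.find_spec hex
    set m := Nat.find hex with hm
    refine hc.not_thetaFree_of_ear (D := {x | ∃ k ≤ m, x = p k}) ?_ hi hj hij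
      ⟨m, p, fun k hk => ⟨k, hk, rfl⟩, hp0, hpm, hp⟩ ?_ hG
    · rintro l hl ⟨k, hk, he⟩
      exact hpR k hk l hl he
    · rintro _ ⟨k, hk, rfl⟩ l hl hadj
      by_cases hli : l = i
      · exact Or.inl hli
      · right
        have hmk : m ≤ k := Nat.find_min' hex ⟨i, hi, l, hl, fun e => hli e.symm, p,
          fun t ht => hpR t (by omega), hp0, hadj.symm, fun t ht => hp t (by omega)⟩
        obtain rfl : k = m := by omega
        exact hc.eq_of_adj_of_adj hG (hpR _ le_rfl) hl hj hadj hpm.symm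

/-- The cycle is triangulated by a fan from `c 0`; its `N - 2` triangles, in order, are the bags of
a path decomposition. -/
theorem IsHole.hasTreeDecomposition {V : Type v} {G : SimpleGraph V} {N : ℕ} {c : ℕ → V}
    (hc : IsHole G N c) (hV : ∀ v, ∃ i < N, c i = v) : HasTreeDecomposition G 3 := by
  classical
  have h4 := hc.four_le
  refine hasTreeDecomposition_of_path (m := N - 3)
    (fun t => {c 0, c (t + 1), c (t + 2)}) (fun t => Finset.card_le_three) ?_ ?_ ?_
  · intro x
    obtain ⟨i, hi, rfl⟩ := hV x
    rcases Nat.eq_zero_or_pos i with rfl | h0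
    · exact ⟨0, by simp⟩
    · by_cases h : i + 1 < N
      · exact ⟨⟨i - 1, by omega⟩, by simp [Nat.sub_add_cancel h0]⟩
      · refine ⟨⟨N - 3, by omega⟩, ?_⟩
        simp [show N - 3 + 2 = i by omega]
  · have key : ∀ i j, i + 1 = j → j < N →
        ∃ t : Fin (N - 3 + 1), c i ∈ ({c 0, c (t + 1), c (t + 2)} : Finset V) ∧
          c j ∈ ({c 0, c (t + 1), c (t + 2)} : Finset V) := by
      rintro i _ rfl hj
      rcases Nat.eq_zero_or_pos i with rfl | h0
      · exact ⟨0, by simp⟩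
      · exact ⟨⟨i - 1, by omega⟩, by simp [Nat.sub_add_cancel h0, show i - 1 + 2 = i + 1 by omega]⟩
    have key' : ∃ t : Fin (N - 3 + 1), c 0 ∈ ({c 0, c (t + 1), c (t + 2)} : Finset V) ∧
          c (N - 1) ∈ ({c 0, c (t + 1), c (t + 2)} : Finset V) :=
      ⟨⟨N - 3, by omega⟩, by simp [show N - 3 + 2 = N - 1 by omega]⟩
    intro x y hxy
    obtain ⟨i, hi, rfl⟩ := hV x
    obtain ⟨j, hj, rfl⟩ := hV y
    rcases (hc.adj i hi j hj).1 hxy with h | h | ⟨rfl, h⟩ | ⟨rfl, h⟩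
    · exact key i j h hj
    · obtain ⟨t, h1, h2⟩ := key j i h hi
      exact ⟨t, h2, h1⟩
    · obtain rfl : j = N - 1 := by omega
      exact key'
    · obtain rfl : i = N - 1 := by omega
      obtain ⟨t, h1, h2⟩ := key'
      exact ⟨t, h2, h1⟩
  · intro x i j l hij hjl hxi hxl
    obtain ⟨q, hq, rfl⟩ := hV x
    have hmem : ∀ t : Fin (N - 3 + 1), c q ∈ ({c 0, c (t + 1), c (t + 2)} : Finset V) ↔
        q = 0 ∨ q = t + 1 ∨ q = t + 2 := by
      intro t
      have ht := t.2
      simp only [Finset.mem_insert, Finset.mem_singleton]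
      refine or_congr ⟨hc.inj _ hq _ (by omega), fun h => by rw [h]⟩
        (or_congr ⟨hc.inj _ hq _ (by omega), fun h => by rw [h]⟩
          ⟨hc.inj _ hq _ (by omega), fun h => by rw [h]⟩)
    rw [hmem] at hxi hxl ⊢
    rw [Fin.le_def] at hij hjl
    omega

/-- An atom has at most `k` vertices or is a cycle, which explains the requirement `3 ≤ k`. -/
theorem hasTreeDecomposition_of_thetaFree {V : Type v} [Finite V] {G : SimpleGraph V} {k : ℕ}
    (h3 : 3 ≤ k) (hk : ∀ s : Finset V, G.IsClique s → s.card ≤ k) (hG : ThetaFree G) :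
    HasTreeDecomposition G k := by
  refine hasTreeDecomposition_of_atoms (k := k)
    (fun V G => (∀ s : Finset V, G.IsClique s → s.card ≤ k) ∧ ThetaFree G)
    (fun V G s h => ⟨isClique_map_induce h.1, fun n hn hn' hc =>
      h.2 n hn hn' (hc.trans (induce_isIndContained G s))⟩) ?_ V G ⟨hk, hG⟩
  intro V _ G ⟨hk, hG⟩ hsep
  by_cases hle : Nat.card V ≤ k
  · exact hasTreeDecomposition_of_card_le G hle
  obtain ⟨a, b, hab, hadj⟩ := exists_not_adj_of_card_lt hk (not_le.1 hle)
  rcases exists_isCliqueSeparation_or_hole hab hadj with ⟨A, B, hAB⟩ |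
    ⟨a, x, y, m, p, hm, hxy, hnadj, hax, hay, hp, hpa⟩
  · exact absurd hAB (hsep A B)
  · have hc := isHole_of_isArc hm hxy hnadj hax hay hp hpa
    obtain ⟨ι, hι, T, hT⟩ := hc.hasTreeDecomposition (hc.exists_eq hG hsep)
    exact ⟨ι, hι, T, fun t => (hT t).trans h3⟩

/-! ### Binding functions -/

instance {m : ℕ} (n : Fin m → ℕ) : DecidableRel (multiTheta n).Adj
  | Sum.inl a, Sum.inl b => inferInstanceAs (Decidable (a ≠ b ∧ ∃ i, n i = 0))
  | Sum.inl a, Sum.inr p =>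
    inferInstanceAs (Decidable ((a = false ∧ p.1.2 = 0) ∨ (a = true ∧ p.1.2 + 1 = n p.1.1)))
  | Sum.inr p, Sum.inl a =>
    inferInstanceAs (Decidable ((a = false ∧ p.1.2 = 0) ∨ (a = true ∧ p.1.2 + 1 = n p.1.1)))
  | Sum.inr p, Sum.inr q =>
    inferInstanceAs (Decidable (p.1.1 = q.1.1 ∧ (p.1.2 + 1 = q.1.2 ∨ q.1.2 + 1 = p.1.2)))

theorem cycleGraph_three_isIndContained_multiTheta :
    (cycleGraph 3).IsIndContained (multiTheta (![0, 1] : Fin 2 → ℕ)) := by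
  let f : Fin 3 → Bool ⊕ {p : Fin 2 × ℕ // p.2 < (![0, 1] : Fin 2 → ℕ) p.1} :=
    ![Sum.inl false, Sum.inl true, Sum.inr ⟨(1, 0), by decide⟩]
  have hf : Function.Injective f := by decide
  have hadj : ∀ i j, (multiTheta _).Adj (f i) (f j) ↔ (cycleGraph 3).Adj i j := by decide
  exact ⟨⟨⟨f, hf⟩, fun {i j} => hadj i j⟩⟩

theorem cycleGraph_four_isIndContained_multiTheta :
    (cycleGraph 4).IsIndContained (multiTheta (![1, 1] : Fin 2 → ℕ)) := by
  let f : Fin 4 → Bool ⊕ {p : Fin 2 × ℕ // p.2 < (![1, 1] : Fin 2 → ℕ) p.1} :=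
    ![Sum.inl false, Sum.inr ⟨(0, 0), by decide⟩, Sum.inl true, Sum.inr ⟨(1, 0), by decide⟩]
  have hf : Function.Injective f := by decide
  have hadj : ∀ i j, (multiTheta _).Adj (f i) (f j) ↔ (cycleGraph 4).Adj i j := by decide
  exact ⟨⟨⟨f, hf⟩, fun {i j} => hadj i j⟩⟩

theorem diamond_isIndContained_multiTheta :
    diamond.IsIndContained (multiTheta (![0, 1, 1] : Fin 3 → ℕ)) := by
  let f : Fin 4 → Bool ⊕ {p : Fin 3 × ℕ // p.2 < (![0, 1, 1] : Fin 3 → ℕ) p.1} :=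
    ![Sum.inr ⟨(1, 0), by decide⟩, Sum.inr ⟨(2, 0), by decide⟩, Sum.inl false, Sum.inl true]
  have hf : Function.Injective f := by decide
  have hadj : ∀ i j, (multiTheta _).Adj (f i) (f j) ↔ i ≠ j ∧ s(i, j) ≠ s(0, 1) := by decide
  exact ⟨⟨⟨f, hf⟩, fun {i j} => (hadj i j).trans (by simp [diamond])⟩⟩

theorem card_le_cliqueNum {V : Type*} [Finite V] {G : SimpleGraph V} (s : Finset V)
    (hs : G.IsClique s) : s.card ≤ G.cliqueNum :=
  IsClique.card_le_cliqueNum (tc := hs)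

/-- A hole has two nonempty arcs between suitable branch vertices, so it subdivides both C₃ (lengths
0, 1) and C₄ (lengths 1, 1). The class therefore consists of chordal graphs. -/
theorem isTwOmegaBinding_of_isIndContained_cycleGraph {U : Type u} {H : SimpleGraph U}
    (hH : H.IsIndContained (cycleGraph 3) ∨ H.IsIndContained (cycleGraph 4)) :
    IsTwOmegaBinding (itmFree.{u, v} H) (fun k => k - 1) := by
  intro V _ G hG s
  refine (hasTreeDecomposition_of_no_hole card_le_cliqueNum fun n hn hc => hG ?_).treewidth_le
  have hc' := hc.trans (induce_isIndContained G s)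
  rcases hH with hH | hH
  · refine IsInducedTopologicalMinor.of_isIndContained
      (hH.trans cycleGraph_three_isIndContained_multiTheta)
      (IsIsoSubdivision.isInducedTopologicalMinor (isIsoSubdivision_multiTheta ?_ ?_) hc')
    · intro i
      fin_cases i
      · exact Nat.zero_le _
      · exact Nat.one_le_iff_ne_zero.2 (hn 1)
    · intro i j
      fin_cases i <;> fin_cases j <;> simp
  · refine IsInducedTopologicalMinor.of_isIndContained
      (hH.trans cycleGraph_four_isIndContained_multiTheta)
      (IsIsoSubdivision.isInducedTopologicalMinor (isIsoSubdivision_multiTheta ?_ ?_) hc')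
    · intro i
      fin_cases i
      · exact Nat.one_le_iff_ne_zero.2 (hn 0)
      · exact Nat.one_le_iff_ne_zero.2 (hn 1)
    · intro i j
      fin_cases i <;> fin_cases j <;> simp

theorem isTwOmegaBinding_of_iso_diamond {U : Type u} {H : SimpleGraph U}
    (hH : Nonempty (H ≃g diamond)) :
    IsTwOmegaBinding (itmFree.{u, v} H) (fun k => max (k - 1) 2) := by
  intro V _ G hG s
  obtain ⟨e⟩ := hH
  have h := (hasTreeDecomposition_of_thetaFree (G := G.induce s)
    (le_max_right (G.induce s).cliqueNum 3)
    (fun t ht => (card_le_cliqueNum t ht).trans (le_max_left _ _)) fun n h1 h2 hc =>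
    hG ?_).treewidth_le
  · refine h.trans ?_
    simp only
    omega
  · refine IsInducedTopologicalMinor.of_isIndContained
      (IsIndContained.trans ⟨e.toEmbedding⟩ diamond_isIndContained_multiTheta)
      (IsIsoSubdivision.isInducedTopologicalMinor (isIsoSubdivision_multiTheta ?_ ?_)
        (hc.trans (induce_isIndContained G s)))
    · intro i
      fin_cases i
      · exact Nat.zero_le _
      · exact Nat.one_le_iff_ne_zero.2 h1
      · exact Nat.one_le_iff_ne_zero.2 h2
    · intro i j
      fin_cases i <;> fin_cases j <;> simp

/-- Ramsey's theorem. -/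
theorem exists_isNClique_or_isNIndepSet (k l : ℕ) :
    ∃ N, ∀ {V : Type} (G : SimpleGraph V) (s : Finset V), N ≤ s.card →
      (∃ t ⊆ s, G.IsNClique k t) ∨ ∃ t ⊆ s, G.IsNIndepSet l t := by
  classical
  induction k generalizing l with
  | zero => exact ⟨0, fun G s _ => Or.inl ⟨∅, by simp, by simp [isNClique_iff]⟩⟩
  | succ k ihk =>
    induction l with
    | zero => exact ⟨0, fun G s _ => Or.inr ⟨∅, by simp, by simp [isNIndepSet_iff]⟩⟩
    | succ l ihl =>
      obtain ⟨N₁, h₁⟩ := ihk (l + 1)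
      obtain ⟨N₂, h₂⟩ := ihl
      -- After removal of `v`, at least `N₁ + N₂` vertices are split into neighbours and
      -- non-neighbours of `v`, and `v` extends the clique or the independent set found there.
      refine ⟨N₁ + N₂ + 1, fun G s hs => ?_⟩
      obtain ⟨v, hv⟩ := Finset.card_pos.1 (show 0 < s.card by omega)
      have hcard := Finset.card_filter_add_card_filter_not (s := s.erase v) (fun w => G.Adj v w)
      rw [Finset.card_erase_of_mem hv] at hcard
      rcases show N₁ ≤ ((s.erase v).filter fun w => G.Adj v w).card ∨
        N₂ ≤ ((s.erase v).filter fun w => ¬ G.Adj v w).card by omega with h | h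
      · rcases h₁ G _ h with ⟨t, ht, hc⟩ | ⟨t, ht, hc⟩
        · refine Or.inl ⟨insert v t, ?_, hc.insert fun b hb => (Finset.mem_filter.1 (ht hb)).2⟩
          exact Finset.insert_subset hv (ht.trans ((Finset.filter_subset _ _).trans
            (Finset.erase_subset _ _)))
        · exact Or.inr ⟨t, ht.trans
            ((Finset.filter_subset _ _).trans (Finset.erase_subset _ _)), hc⟩
      · rcases h₂ G _ h with ⟨t, ht, hc⟩ | ⟨t, ht, hc⟩
        · exact Or.inl ⟨t, ht.trans
            ((Finset.filter_subset _ _).trans (Finset.erase_subset _ _)), hc⟩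
        · refine Or.inr ⟨insert v t, ?_, ?_⟩
          · exact Finset.insert_subset hv (ht.trans ((Finset.filter_subset _ _).trans
              (Finset.erase_subset _ _)))
          · rw [← isNClique_compl] at hc ⊢
            refine hc.insert fun b hb => ?_
            have := Finset.mem_filter.1 (ht hb)
            rw [compl_adj]
            exact ⟨(Finset.ne_of_mem_erase this.1).symm, this.2⟩

theorem exists_of_ramseyNumber_le {k l m : ℕ} (h : ramseyNumber k l ≤ m) (G : SimpleGraph (Fin m)) :
    (∃ s, G.IsNClique k s) ∨ ∃ s, G.IsNIndepSet l s := by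
  have hne : {n : ℕ | 0 < n ∧ ∀ m : ℕ, n ≤ m → ∀ G : SimpleGraph (Fin m),
      (∃ s, G.IsNClique k s) ∨ ∃ s, G.IsNIndepSet l s}.Nonempty := by
    obtain ⟨N, hN⟩ := exists_isNClique_or_isNIndepSet k l
    refine ⟨N + 1, Nat.succ_pos _, fun m hm G => ?_⟩
    rcases hN G Finset.univ (by rw [Finset.card_univ, Fintype.card_fin]; omega) with
      ⟨t, -, ht⟩ | ⟨t, -, ht⟩
    · exact Or.inl ⟨t, ht⟩
    · exact Or.inr ⟨t, ht⟩
  exact (Nat.sInf_mem hne).2 m h G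

/-- An independent set of size |U| is a copy of the forbidden graph, so an induced subgraph with
clique number ω has at most R(ω + 1, |U|) - 1 vertices. A single bag then gives the bound. -/
theorem isTwOmegaBinding_bot (U : Type u) [Finite U] :
    IsTwOmegaBinding (itmFree.{u, v} (⊥ : SimpleGraph U))
      (fun k => ramseyNumber (k + 1) (Nat.card U) - 2) := by
  intro V _ G hG s
  have h := (hasTreeDecomposition_of_card_le (G.induce s) le_rfl).treewidth_le
  suffices hlt : Nat.card s < ramseyNumber ((G.induce s).cliqueNum + 1) (Nat.card U) by
    refine h.trans ?_
    simp only
    omega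
  by_contra! hle
  let e : s ≃ Fin (Nat.card s) := Finite.equivFin s
  let G' : SimpleGraph (Fin (Nat.card s)) := (G.induce s).map e.toEmbedding
  let φ : G.induce s ≃g G' := Iso.map e (G.induce s)
  rcases exists_of_ramseyNumber_le hle G' with ⟨t, ht⟩ | ⟨t, ht⟩
  · have hcl : (G.induce s).IsClique (t.map φ.symm.toEquiv.toEmbedding : Finset s) := by
      intro x hx y hy hxy
      simp only [Finset.coe_map, Set.mem_image, Finset.mem_coe] at hx hy
      obtain ⟨x, hx, rfl⟩ := hx
      obtain ⟨y, hy, rfl⟩ := hy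
      exact φ.symm.map_adj_iff.2 (ht.isClique hx hy fun e => hxy (by rw [e]))
    have := card_le_cliqueNum _ hcl
    rw [Finset.card_map, ht.card_eq] at this
    omega
  · apply hG
    have := Fintype.ofFinite U
    have hcard : Fintype.card U = Fintype.card t := by
      rw [Fintype.card_coe, ht.card_eq, Nat.card_eq_fintype_card]
    let g : U ≃ t := Fintype.equivOfCardEq hcard
    refine ⟨U, ⊥, .refl, IsIndContained.trans ⟨⟨⟨fun x => φ.symm (g x).1, fun x y hxy => ?_⟩, ?_⟩⟩
      (induce_isIndContained G s)⟩
    · exact g.injective (Subtype.ext (φ.symm.injective hxy))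
    · intro x y
      change (G.induce s).Adj (φ.symm (g x).1) (φ.symm (g y).1) ↔ False
      rw [φ.symm.map_adj_iff, iff_false]
      intro hadj
      exact ht.isIndepSet (g x).2 (g y).2 hadj.ne hadj

/-! ### Families of large treewidth -/

theorem preconnected_induce_range {α β : Type*} {G : SimpleGraph α} {G' : SimpleGraph β}
    (f : G →g G') (hG : G.Preconnected) : (G'.induce (Set.range f)).Preconnected := by
  rintro ⟨_, a, rfl⟩ ⟨_, b, rfl⟩
  exact (hG a b).map (⟨fun x => ⟨f x, x, rfl⟩, fun h => f.map_adj h⟩ :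
    G →g G'.induce (Set.range f))

/-- The grid bramble: `m + 1` rows and `m + 1` columns, such that each union of a row and a column
is connected and each row touches each column, force treewidth at least `m`. -/
theorem le_treewidth_of_crosses {V : Type v} [Finite V] {G : SimpleGraph V} {m : ℕ}
    (f : V → Bool × Fin (m + 1))
    (hconn : ∀ i j, (G.induce {x | f x = (true, i) ∨ f x = (false, j)}).Preconnected)
    (htouch : ∀ i j, ∃ x y, f x = (true, i) ∧ f y = (false, j) ∧ G.Adj x y) :
    m ≤ treewidth G := by
  classical
  refine le_treewidth_of_bramble (κ := Fin (m + 1) × Fin (m + 1))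
    (fun k => {x | f x = (true, k.1) ∨ f x = (false, k.2)}) (fun k => hconn k.1 k.2) ?_ ?_
  · rintro ⟨i, j⟩ ⟨k, l⟩
    obtain ⟨x, y, hx, hy, h⟩ := htouch i l
    exact ⟨x, Or.inl hx, y, Or.inr hy, Or.inr h⟩
  · intro X hX
    have key : ∀ b : Bool, (∀ i, ∃ x ∈ X, f x = (b, i)) → m < X.card := by
      intro b hb
      have hsub : (Finset.univ : Finset (Fin (m + 1))) ⊆ X.image fun x => (f x).2 := by
        intro i _
        obtain ⟨x, hx, hxi⟩ := hb i
        exact Finset.mem_image.2 ⟨x, hx, by rw [hxi]⟩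
      have := (Finset.card_le_card hsub).trans Finset.card_image_le
      rw [Finset.card_univ, Fintype.card_fin] at this
      omega
    -- A set that meets all crosses meets all rows, or misses some row and then has to meet every
    -- column.
    by_cases h : ∀ i, ∃ x ∈ X, f x = (true, i)
    · exact key true h
    · push Not at h
      obtain ⟨i, hi⟩ := h
      refine key false fun j => ?_
      obtain ⟨x, hx | hx, hxX⟩ := hX (i, j)
      · exact absurd hx (hi x hxX)
      · exact ⟨x, hxX, hx⟩

/-- A family with bounded clique number and unbounded treewidth cannot lie inside the class. As `f`
need not be monotone, its maximum over `0, …, K` is used. -/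
theorem IsTwOmegaBounded.exists_isInducedTopologicalMinor {U : Type u} {H : SimpleGraph U}
    (hH : IsTwOmegaBounded (itmFree.{u, v} H)) {V : ℕ → Type v} [∀ m, Finite (V m)]
    (G : ∀ m, SimpleGraph (V m)) {K : ℕ}
    (hω : ∀ m (s : Finset (V m)), (G m).IsClique s → s.card ≤ K)
    (htw : ∀ m, m ≤ treewidth (G m)) : ∃ m, IsInducedTopologicalMinor H (G m) := by
  obtain ⟨f, hf⟩ := hH
  by_contra! hcon
  set M := (Finset.range (K + 1)).sup f with hM
  set m := M + 1 with hm
  have h1 := hf (V m) (G m) (hcon m) Set.univ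
  have h2 : ((G m).induce Set.univ).cliqueNum ≤ K := by
    obtain ⟨t, ht⟩ := ((G m).induce Set.univ).exists_isNClique_cliqueNum
    rw [← ht.card_eq]
    exact isClique_map_induce (hω m) t ht.isClique
  have h3 : f ((G m).induce Set.univ).cliqueNum ≤ M :=
    Finset.le_sup (f := f) (Finset.mem_range.2 (by omega))
  have h4 := ((hasTreeDecomposition_of_treewidth_le (h1.trans h3)).of_iso
    (induceUnivIso (G m))).treewidth_le
  have h5 := htw m
  omega

/-- The balanced complete bipartite graph. -/
def balancedBipartite (m : ℕ) : SimpleGraph (ULift.{v} (Bool × Fin (m + 1))) where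
  Adj x y := x.down.1 ≠ y.down.1
  symm := ⟨fun _ _ h => h.symm⟩
  loopless := ⟨fun _ h => h rfl⟩

theorem le_treewidth_balancedBipartite (m : ℕ) : m ≤ treewidth (balancedBipartite.{v} m) := by
  refine le_treewidth_of_crosses (fun x => x.down) (fun i j => ?_)
    fun i j => ⟨⟨true, i⟩, ⟨false, j⟩, rfl, rfl, Bool.noConfusion⟩
  have hset : {x : ULift.{v} (Bool × Fin (m + 1)) | x.down = (true, i) ∨ x.down = (false, j)} =
      {⟨true, i⟩, ⟨false, j⟩} := by
    ext ⟨x⟩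
    exact or_congr ⟨congrArg ULift.up, congrArg ULift.down⟩ ⟨congrArg ULift.up, congrArg ULift.down⟩
  rw [hset]
  exact (induce_pair_connected_of_adj (G := balancedBipartite.{v} m) (u := ⟨true, i⟩)
    (v := ⟨false, j⟩) Bool.noConfusion).preconnected

theorem card_le_of_isClique_balancedBipartite (m : ℕ) (s : Finset (ULift.{v} (Bool × Fin (m + 1))))
    (hs : (balancedBipartite m).IsClique s) : s.card ≤ 8 := by
  have := Finset.card_le_card_of_injOn (t := (Finset.univ : Finset Bool)) (fun x => x.down.1)
    (fun _ _ => Finset.mem_univ _) (s := s) (fun x hx y hy h => by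
      by_contra hne
      exact hs hx hy hne h)
  simp at this
  omega

/-- `z` is an end of the edge `(b, i, j)` of the grid, which joins `(i, j)` to `(i, j + 1)` or
`(i + 1, j)`, depending on `b`. -/
def gridEnd {m : ℕ} (x : Bool × Fin (m + 1) × Fin (m + 1)) (z : ℕ × ℕ) : Prop :=
  z = (x.2.1.1, x.2.2.1) ∨
    z = if x.1 then (x.2.1.1, x.2.2.1 + 1) else (x.2.1.1 + 1, x.2.2.1)

/-- The line graph of a grid. -/
def gridLineGraph (m : ℕ) : SimpleGraph (ULift.{v} (Bool × Fin (m + 1) × Fin (m + 1))) where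
  Adj x y := x ≠ y ∧ ∃ z, gridEnd x.down z ∧ gridEnd y.down z
  symm := ⟨fun _ _ h => ⟨h.1.symm, h.2.imp fun _ hz => hz.symm⟩⟩
  loopless := ⟨fun _ h => h.1 rfl⟩

theorem le_treewidth_gridLineGraph (m : ℕ) : m ≤ treewidth (gridLineGraph.{v} m) := by
  -- Row `i` consists of the grid edges `(true, i, ·)` and column `j` of the edges `(false, ·, j)`.
  -- They touch because two of these edges meet at the grid vertex `(i, j)`.
  have hcross : ∀ i j, (gridLineGraph.{v} m).Adj ⟨true, i, j⟩ ⟨false, i, j⟩ := fun i j =>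
    ⟨by simp, (i.1, j.1), Or.inl rfl, Or.inl rfl⟩
  refine le_treewidth_of_crosses (fun x => (x.down.1, if x.down.1 then x.down.2.1 else x.down.2.2))
    (fun i j => ?_) fun i j => ⟨⟨true, i, j⟩, ⟨false, i, j⟩, rfl, rfl, hcross i j⟩
  let row : pathGraph (m + 1) →g gridLineGraph.{v} m := ⟨fun k => ⟨true, i, k⟩, fun {a b} h => by
    refine ⟨fun e => h.ne (congrArg (fun x => x.down.2.2) e), ?_⟩
    rcases pathGraph_adj.1 h with h | h
    · exact ⟨(i.1, b.1), Or.inr (by simp [h]), Or.inl rfl⟩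
    · exact ⟨(i.1, a.1), Or.inl rfl, Or.inr (by simp [h])⟩⟩
  let col : pathGraph (m + 1) →g gridLineGraph.{v} m := ⟨fun k => ⟨false, k, j⟩, fun {a b} h => by
    refine ⟨fun e => h.ne (congrArg (fun x => x.down.2.1) e), ?_⟩
    rcases pathGraph_adj.1 h with h | h
    · exact ⟨(b.1, j.1), Or.inr (by simp [h]), Or.inl rfl⟩
    · exact ⟨(a.1, j.1), Or.inl rfl, Or.inr (by simp [h])⟩⟩
  have hset : {x : ULift.{v} (Bool × Fin (m + 1) × Fin (m + 1)) |
      (x.down.1, if x.down.1 then x.down.2.1 else x.down.2.2) = (true, i) ∨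
        (x.down.1, if x.down.1 then x.down.2.1 else x.down.2.2) = (false, j)} =
      Set.range row ∪ Set.range col := by
    ext ⟨b, k, l⟩
    constructor
    · cases b
      · rintro (h | h)
        · simp at h
        · obtain rfl : l = j := by simpa using h
          exact Or.inr ⟨k, rfl⟩
      · rintro (h | h)
        · obtain rfl : k = i := by simpa using h
          exact Or.inl ⟨l, rfl⟩
        · simp at h
    · rintro (⟨a, h⟩ | ⟨a, h⟩)
      · obtain ⟨⟩ := h
        exact Or.inl rfl
      · obtain ⟨⟩ := h
        exact Or.inr rfl
  rw [hset]
  exact (connected_induce_union (preconnected_induce_range row (pathGraph_preconnected _))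
    (preconnected_induce_range col (pathGraph_preconnected _)) ⟨j, rfl⟩ ⟨i, rfl⟩
    (hcross i j)).preconnected

/-- Distinct grid edges of the same direction that share an end differ by 1 in one coordinate. So
direction and the two parities separate the members of a clique, whence 8 = 2 · 2 · 2. -/
theorem card_le_of_isClique_gridLineGraph (m : ℕ)
    (s : Finset (ULift.{v} (Bool × Fin (m + 1) × Fin (m + 1))))
    (hs : (gridLineGraph m).IsClique s) : s.card ≤ 8 := by
  have := Finset.card_le_card_of_injOn (t := (Finset.univ : Finset (Bool × Fin 2 × Fin 2)))
    (fun x => (x.down.1, Fin.ofNat 2 x.down.2.1, Fin.ofNat 2 x.down.2.2))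
    (fun _ _ => Finset.mem_univ _) (s := s) (by
      rintro ⟨b, i, j⟩ hx ⟨c, k, l⟩ hy h
      by_contra hne
      obtain ⟨z, hz, hz'⟩ := (hs hx hy hne).2
      simp only [Prod.mk.injEq, Fin.ext_iff, Fin.ofNat] at h
      apply hne
      simp only [gridEnd] at hz hz'
      obtain ⟨rfl, h1, h2⟩ := h
      have : i = k ∧ j = l := by
        rw [Fin.ext_iff, Fin.ext_iff]
        cases b <;> rcases hz with rfl | rfl <;> simp at hz' <;> omega
      rw [this.1, this.2])
  simpa using this

/-! ### Claws -/

/-- `G` contains an induced claw `K_{1,3}`. -/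
def HasClaw {V : Type*} (G : SimpleGraph V) : Prop :=
  ∃ v a b c, G.Adj v a ∧ G.Adj v b ∧ G.Adj v c ∧ a ≠ b ∧ a ≠ c ∧ b ≠ c ∧
    ¬ G.Adj a b ∧ ¬ G.Adj a c ∧ ¬ G.Adj b c

theorem HasClaw.of_isIndContained {V W : Type*} {G : SimpleGraph V} {G' : SimpleGraph W}
    (h : HasClaw G) (hc : G.IsIndContained G') : HasClaw G' := by
  obtain ⟨f⟩ := hc
  obtain ⟨v, a, b, c, h⟩ := h
  exact ⟨f v, f a, f b, f c, by simpa using h⟩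

/-- If an edge of the claw is subdivided, the new vertex replaces its leaf. Otherwise the claw is
untouched. -/
theorem HasClaw.subdivideEdge {V : Type*} {G : SimpleGraph V} (h : HasClaw G) (x y : V) :
    HasClaw (subdivideEdge G x y) := by
  obtain ⟨v, a, b, c, ha, hb, hc, hab, hac, hbc, nab, nac, nbc⟩ := h
  have key : ∀ a b c, G.Adj v a → G.Adj v b → G.Adj v c → a ≠ b → a ≠ c → b ≠ c →
      ¬ G.Adj a b → ¬ G.Adj a c → ¬ G.Adj b c → s(v, a) = s(x, y) →
      HasClaw (TwOmega.subdivideEdge G x y) := by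
    intro a b c ha hb hc hab hac hbc nab nac nbc he
    have hxy : (v = x ∧ a = y) ∨ (v = y ∧ a = x) := by simpa using he
    refine ⟨some v, none, some b, some c, ?_, ⟨hb, ?_⟩, ⟨hc, ?_⟩, by simp, by simp,
      by simpa using hbc, ?_, ?_, fun h => nbc h.1⟩
    · exact hxy.imp And.left And.left
    · rw [← he]
      simpa using ⟨hab.symm, fun _ => hb.ne.symm⟩
    · rw [← he]
      simpa using ⟨hac.symm, fun _ => hc.ne.symm⟩
    · change ¬ (b = x ∨ b = y)
      have := hb.ne
      grind
    · change ¬ (c = x ∨ c = y)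
      have := hc.ne
      grind
  by_cases h1 : s(v, a) = s(x, y)
  · exact key a b c ha hb hc hab hac hbc nab nac nbc h1
  by_cases h2 : s(v, b) = s(x, y)
  · exact key b a c hb ha hc hab.symm hbc hac (fun h => nab h.symm) nbc nac h2
  by_cases h3 : s(v, c) = s(x, y)
  · exact key c a b hc ha hb hac.symm hbc.symm hab (fun h => nac h.symm)
      (fun h => nbc h.symm) nab h3
  exact ⟨some v, some a, some b, some c, ⟨ha, h1⟩, ⟨hb, h2⟩, ⟨hc, h3⟩, by simpa, by simpa, by simpa,
    fun h => nab h.1, fun h => nac h.1, fun h => nbc h.1⟩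

theorem HasClaw.of_isSubdivision {U W : Type u} {H : SimpleGraph U} {K : SimpleGraph W}
    (h : HasClaw H) (hK : IsSubdivision H W K) : HasClaw K := by
  induction hK with
  | refl => exact h
  | step _ _ ih => exact ih.subdivideEdge _ _

/-- Each leaf of a claw would share one of the two ends of the centre, so two leaves would share the
same end and be adjacent. -/
theorem not_hasClaw_gridLineGraph (m : ℕ) : ¬ HasClaw (gridLineGraph.{v} m) := by
  rintro ⟨v, a, b, c, ⟨-, x, hvx, hax⟩, ⟨-, y, hvy, hby⟩, ⟨-, z, hvz, hcz⟩, hab, hac, hbc, nab,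
    nac, nbc⟩
  have hxy : x ≠ y := by
    rintro rfl
    exact nab ⟨hab, x, hax, hby⟩
  have hxz : x ≠ z := by
    rintro rfl
    exact nac ⟨hac, x, hax, hcz⟩
  have hyz : y ≠ z := by
    rintro rfl
    exact nbc ⟨hbc, y, hby, hcz⟩
  unfold gridEnd at hvx hvy hvz
  grind

/-! ### Graphs with a complete bipartite subdivision -/

/-- `G` is complete bipartite (possibly with an empty side). -/
def IsCompleteBip {V : Type*} (G : SimpleGraph V) : Prop :=
  ∃ c : V → Bool, ∀ a b, G.Adj a b ↔ c a ≠ c b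

/-- `G` is a book `K_{1,1,q}`. -/
def IsBook {V : Type*} (G : SimpleGraph V) : Prop :=
  ∃ x y, G.Adj x y ∧ (∀ z, z ≠ x → z ≠ y → G.Adj z x ∧ G.Adj z y) ∧
    ∀ z w, z ≠ x → z ≠ y → w ≠ x → w ≠ y → ¬ G.Adj z w

/-- The new vertex has exactly two neighbours, and these are nonadjacent. As a page its neighbours
would be the adjacent spine vertices; as a spine vertex, the other spine vertex would be one of its
neighbours and adjacent to everything. -/
theorem not_isBook_subdivideEdge {V : Type*} {G : SimpleGraph V} {x y : V} (hxy : G.Adj x y) :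
    ¬ IsBook (subdivideEdge G x y) := by
  have hn : ¬ (subdivideEdge G x y).Adj (some x) (some y) := fun h => h.2 rfl
  have hne : ∀ z, (subdivideEdge G x y).Adj none z → z = some x ∨ z = some y := by
    rintro (_ | z) h
    · exact h.elim
    · exact h.imp (congrArg some) (congrArg some)
  have key : ∀ z, (∀ w, w ≠ none → w ≠ z → (subdivideEdge G x y).Adj w none ∧
      (subdivideEdge G x y).Adj w z) → ¬ (subdivideEdge G x y).Adj none z := by
    intro z h h0
    rcases hne z h0 with rfl | rfl
    · exact hn (h (some y) (by simp) (by simpa using hxy.ne.symm)).2.symm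
    · exact hn (h (some x) (by simp) (by simpa using hxy.ne)).2
  rintro ⟨p, q, hpq, h1, -⟩
  by_cases hp : p = none
  · subst hp
    exact key q h1 hpq
  by_cases hq : q = none
  · subst hq
    exact key p (fun w h h' => (h1 w h' h).symm) hpq.symm
  have h2 := h1 none (Ne.symm hp) (Ne.symm hq)
  rcases hne p h2.1 with rfl | rfl <;> rcases hne q h2.2 with rfl | rfl
  · exact hpq.ne rfl
  · exact hn hpq
  · exact hn hpq.symm
  · exact hpq.ne rfl

/-- The vertices `x` and `y` make up the side opposite to the new vertex. All others share its side,
so they are independent and adjacent to both `x` and `y`, which form the spine. -/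
theorem isBook_of_isCompleteBip_subdivideEdge {V : Type*} {G : SimpleGraph V} {x y : V}
    (hxy : G.Adj x y) (h : IsCompleteBip (subdivideEdge G x y)) : IsBook G := by
  obtain ⟨c, hc⟩ := h
  have hx : c none ≠ c (some x) := (hc none (some x)).1 (Or.inl rfl)
  have hy : c none ≠ c (some y) := (hc none (some y)).1 (Or.inr rfl)
  have hz : ∀ z, z ≠ x → z ≠ y → c (some z) = c none := fun z h1 h2 => by
    by_contra hcon
    rcases (hc none (some z)).2 (Ne.symm hcon) with h | h
    · exact h1 h
    · exact h2 h
  refine ⟨x, y, hxy, fun z h1 h2 => ⟨?_, ?_⟩, fun z w h1 h2 h3 h4 h => ?_⟩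
  · exact ((hc (some z) (some x)).2 (by rwa [hz z h1 h2])).1
  · exact ((hc (some z) (some y)).2 (by rwa [hz z h1 h2])).1
  · refine (hc (some z) (some w)).1 ⟨h, ?_⟩ (by rw [hz z h1 h2, hz w h3 h4])
    simp [h1, h2]

theorem IsSubdivision.isCompleteBip_or_isBook {U W : Type u} {H : SimpleGraph U}
    {K : SimpleGraph W} (hK : IsSubdivision H W K) (h : IsCompleteBip K ∨ IsBook K) :
    IsCompleteBip H ∨ IsBook H := by
  induction hK with
  | refl => exact h
  | step hK hxy ih =>
    rcases h with h | h
    · exact ih (Or.inr (isBook_of_isCompleteBip_subdivideEdge hxy h))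
    · exact absurd h (not_isBook_subdivideEdge hxy)

theorem IsCompleteBip.of_isIndContained {V W : Type*} {G : SimpleGraph V} {G' : SimpleGraph W}
    (h : IsCompleteBip G') (hc : G.IsIndContained G') : IsCompleteBip G := by
  obtain ⟨f⟩ := hc
  obtain ⟨c, hc⟩ := h
  exact ⟨fun x => c (f x), fun a b => by rw [← f.map_adj_iff, hc]⟩

/-- A complete bipartite graph without claws and with an edge is an induced subgraph of `C₄`. -/
theorem IsCompleteBip.isIndContained_cycleGraph_four {V : Type*} {G : SimpleGraph V}
    (h : IsCompleteBip G) (hne : G ≠ ⊥) (hclaw : ¬ HasClaw G) :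
    G.IsIndContained (cycleGraph 4) := by
  classical
  obtain ⟨c, hc⟩ := h
  obtain ⟨a, b, hab⟩ := G.ne_bot_iff_exists_adj.1 hne
  have hrep : ∀ t : Bool, ∃ x, c x = t := fun t => by
    have := (hc a b).1 hab
    by_cases ha : c a = t
    · exact ⟨a, ha⟩
    · refine ⟨b, ?_⟩
      revert this ha
      cases c a <;> cases c b <;> cases t <;> simp
  choose r hr using hrep
  -- A side with three vertices would form a claw with a vertex of the other side. So a vertex is
  -- determined by its side and by whether it is the chosen representative `r` of that side.
  let g : Bool → Bool → Fin 4 := fun t e => if t then (if e then 1 else 3) else (if e then 0 else 2)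
  have hg : ∀ t e t' e', (cycleGraph 4).Adj (g t e) (g t' e') ↔ t ≠ t' := by decide
  have hginj : ∀ t e t' e', g t e = g t' e' → t = t' ∧ e = e' := by decide
  refine ⟨⟨⟨fun x => g (c x) (decide (x = r (c x))), fun x y hxy => ?_⟩, fun {x y} => ?_⟩⟩
  · obtain ⟨h1, h2⟩ := hginj _ _ _ _ hxy
    by_contra hne
    rw [← h1, decide_eq_decide] at h2
    have hx : x ≠ r (c x) := fun h => hne (h.trans (h2.1 h).symm)
    have hy : y ≠ r (c x) := fun h => hx (h2.2 h)
    refine hclaw ⟨r (!c x), x, y, r (c x), ?_, ?_, ?_, hne, hx, hy, ?_, ?_, ?_⟩ <;>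
      simp [hc, hr, ← h1]
  · exact (hg _ _ _ _).trans (hc x y).symm

theorem isIndContained_cycleGraph_three {V : Type*} {G : SimpleGraph V} (f : V → Fin 3)
    (hf : Function.Injective f) (hG : ∀ x y, x ≠ y → G.Adj x y) :
    G.IsIndContained (cycleGraph 3) := by
  refine ⟨⟨⟨f, hf⟩, fun {x y} => ?_⟩⟩
  change (cycleGraph 3).Adj (f x) (f y) ↔ G.Adj x y
  rw [cycleGraph_three_eq_top, top_adj, hf.ne_iff]
  exact ⟨hG x y, fun h => h.ne⟩

/-- A book without claws is an induced subgraph of `C₃` or the diamond. -/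
theorem IsBook.isIndContained_or_iso {V : Type*} {G : SimpleGraph V} (h : IsBook G)
    (hclaw : ¬ HasClaw G) : G.IsIndContained (cycleGraph 3) ∨ Nonempty (G ≃g diamond) := by
  classical
  obtain ⟨x, y, hxy, h1, h2⟩ := h
  by_cases hz : ∃ z w, z ≠ w ∧ z ≠ x ∧ z ≠ y ∧ w ≠ x ∧ w ≠ y
  · right
    obtain ⟨z, w, hzw, hzx, hzy, hwx, hwy⟩ := hz
    -- A third page would give a claw centred at the spine vertex `x`.
    have hall : ∀ u, u = z ∨ u = w ∨ u = x ∨ u = y := by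
      intro u
      by_contra! hu
      obtain ⟨huz, huw, hux, huy⟩ := hu
      exact hclaw ⟨x, z, w, u, (h1 z hzx hzy).1.symm, (h1 w hwx hwy).1.symm, (h1 u hux huy).1.symm,
        hzw, huz.symm, huw.symm, h2 _ _ hzx hzy hwx hwy, h2 _ _ hzx hzy hux huy,
        h2 _ _ hwx hwy hux huy⟩
    have hbij : Function.Bijective ![z, w, x, y] := by
      constructor
      · intro i j
        fin_cases i <;> fin_cases j <;>
          simp [hzw, hzx, hzy, hwx, hwy, hxy.ne, hzw.symm, hzx.symm, hzy.symm, hwx.symm, hwy.symm,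
            hxy.ne.symm]
      · intro u
        rcases hall u with rfl | rfl | rfl | rfl
        exacts [⟨0, rfl⟩, ⟨1, rfl⟩, ⟨2, rfl⟩, ⟨3, rfl⟩]
    refine ⟨RelIso.symm ⟨Equiv.ofBijective _ hbij, ?_⟩⟩
    intro i j
    have e1 := h1 z hzx hzy
    have e2 := h1 w hwx hwy
    have e3 := h2 z w hzx hzy hwx hwy
    have e3' := h2 w z hwx hwy hzx hzy
    fin_cases i <;> fin_cases j <;>
      simp [diamond, e1, e2, e3, hxy, e1.1.symm, e1.2.symm, e2.1.symm, e2.2.symm, hxy.symm,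
        e3']
  · left
    push Not at hz
    refine isIndContained_cycleGraph_three
      (fun u => if u = x then 0 else if u = y then 1 else 2) ?_ ?_
    · intro u w huw
      by_contra hne
      have := hz u w hne
      dsimp only at huw
      split_ifs at huw <;> simp_all
    · intro u w huw
      by_cases hux : u = x
      · subst hux
        by_cases hwy : w = y
        · rwa [hwy]
        · exact (h1 w huw.symm hwy).1.symm
      by_cases huy : u = y
      · subst huy
        by_cases hwx : w = x
        · rw [hwx]
          exact hxy.symm
        · exact (h1 w hwx huw.symm).2.symm
      by_cases hwx : w = x
      · rw [hwx]
        exact (h1 u hux huy).1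
      rw [hz u w huw hux huy hwx]
      exact (h1 u hux huy).2

/-- Grid line graphs exclude claws from H, and complete bipartite graphs make H complete bipartite
or a book; the two restrictions together leave only the listed graphs. -/
theorem IsTwOmegaBounded.forbidden_cases {U : Type u} {H : SimpleGraph U}
    (hH : IsTwOmegaBounded (itmFree.{u, v} H)) :
    (H.IsIndContained (cycleGraph 3) ∨ H.IsIndContained (cycleGraph 4)) ∨
      Nonempty (H ≃g diamond) ∨ H = ⊥ := by
  obtain ⟨m, W, K, hK, hKc⟩ := hH.exists_isInducedTopologicalMinor (fun m => balancedBipartite m)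
    card_le_of_isClique_balancedBipartite le_treewidth_balancedBipartite
  obtain ⟨m', W', K', hK', hKc'⟩ := hH.exists_isInducedTopologicalMinor (fun m => gridLineGraph m)
    card_le_of_isClique_gridLineGraph le_treewidth_gridLineGraph
  have hclaw : ¬ HasClaw H := fun h =>
    not_hasClaw_gridLineGraph m' ((h.of_isSubdivision hK').of_isIndContained hKc')
  have hbip : IsCompleteBip (balancedBipartite.{v} m) := ⟨fun x => x.down.1, fun _ _ => Iff.rfl⟩
  rcases hK.isCompleteBip_or_isBook (Or.inl (hbip.of_isIndContained hKc)) with h | h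
  · by_cases hbot : H = ⊥
    · exact Or.inr (Or.inr hbot)
    · exact Or.inl (Or.inr (h.isIndContained_cycleGraph_four hbot hclaw))
  · rcases h.isIndContained_or_iso hclaw with h | h
    · exact Or.inl (Or.inl h)
    · exact Or.inr (Or.inl h)

end TwOmega

/-! ### The characterisation with its binding functions -/

theorem mainTheorem3 {U : Type u} [Finite U] (H : SimpleGraph U) :
    (TwOmega.IsTwOmegaBounded (TwOmega.itmFree.{u, v} H) ↔
      (H.IsIndContained (SimpleGraph.cycleGraph 3) ∨ H.IsIndContained (SimpleGraph.cycleGraph 4)) ∨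
        Nonempty (H ≃g TwOmega.diamond) ∨
        H = ⊥) ∧
    ((H.IsIndContained (SimpleGraph.cycleGraph 3) ∨ H.IsIndContained (SimpleGraph.cycleGraph 4)) →
      TwOmega.IsTwOmegaBinding (TwOmega.itmFree.{u, v} H) (fun k => k - 1)) ∧
    (Nonempty (H ≃g TwOmega.diamond) →
      TwOmega.IsTwOmegaBinding (TwOmega.itmFree.{u, v} H) (fun k => max (k - 1) 2)) ∧
    (H = ⊥ →
      TwOmega.IsTwOmegaBinding (TwOmega.itmFree.{u, v} H)
        (fun k => TwOmega.ramseyNumber (k + 1) (Nat.card U) - 2)) := by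
  have h1 := TwOmega.isTwOmegaBinding_of_isIndContained_cycleGraph.{u, v} (H := H)
  have h2 := TwOmega.isTwOmegaBinding_of_iso_diamond.{u, v} (H := H)
  have h3 : H = ⊥ → TwOmega.IsTwOmegaBinding (TwOmega.itmFree.{u, v} H)
        (fun k => TwOmega.ramseyNumber (k + 1) (Nat.card U) - 2) := by
    rintro rfl
    exact TwOmega.isTwOmegaBinding_bot U
  refine ⟨⟨fun h => h.forbidden_cases, ?_⟩, h1, h2, h3⟩
  rintro (h | h | h)
  exacts [⟨_, h1 h⟩, ⟨_, h2 h⟩, ⟨_, h3 h⟩]
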